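/- Let $n\ge 2$ and let $B_n$ be the $n$-strand braid group with Artin generators $\sigma_1,\dots,\sigma_{n-1}$. For $1\le i<j\le n$ let $a_{ij}=(\sigma_{j-1}\sigma_{j-2}\cdots\sigma_{i+1})\,\sigma_i\,(\sigma_{j-1}\sigma_{j-2}\cdots\sigma_{i+1})^{-1}$ (the band generators), and let $\delta=\sigma_{n-1}\cdots\sigma_2\sigma_1$. For $\beta\in B_n$ let $\|\beta\|$ be the least length, and $\mathrm{nb}(\beta)$ the least number of inverse letters $a_{ij}^{-1}$, of a word in the $a_{ij}^{\pm1}$ representing $\beta$. The braid $\beta$ is strongly quasipositive (SQP) if $\mathrm{nb}(\beta)=0$, and almost strongly quasipositive (ASQP) if $\mathrm{nb}(\beta)\le 1$. Write $V\le W$ if $W=PVQ$ with $P,Q$ SQP, and put $\inf(\beta)=\max\{r\in\mathbb Z:\delta^r\le\beta\}$, $\sup(\beta)=\min\{s\in\mathbb Z:\beta\le\delta^s\}$, $\ell(\beta)=\sup(\beta)-\inf(\beta)$. The super summit set $\mathrm{SSS}([\beta])$ is the set of conjugates $\beta'$ of $\beta$ with $\ell(\beta')$ minimal among all conjugates of $\beta$.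 A canonical factor is a braid $A$ with $e\le A\le\delta$. For canonical factors $A,B$, the word $AB$ is maximally left-weighted if, whenever $A',B'$ are canonical factors with $AB=A'B'$ in $B_n$ and $A'=AQ$ for some canonical factor $Q$, one has $A'=A$ and $B'=B$. The left-canonical form (LCF) of $\beta$ is the unique expression $\beta=\delta^rA_1\cdots A_k$ with $r\in\mathbb Z$, $k\ge0$, canonical factors $A_i\notin\{e,\delta\}$, and every $A_iA_{i+1}$ maximally left-weighted. **Proposition.** Let $\beta\in B_n$. Suppose there is $\beta'\in\mathrm{SSS}([\beta])$ with $\inf(\beta')=-1$ such that at least one canonical factor $A_i$ in its left-canonical form $\delta^{-1}A_1\cdots A_k$ has $\|A_i\|=n-2$. Then $\beta$ is conjugate to an ASQP braid, but is not conjugate to any SQP braid. -/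

import Mathlib

/-! Braid groups, band generators, and the Birman-Ko-Lee left-canonical form. -/

namespace BraidGrp

/-- Indices of the Artin generators `σ₁, …, σ_{n-1}` of the braid group on `n` strands. -/
abbrev Idx (n : ℕ) : Type := {i : ℕ // 1 ≤ i ∧ i < n}

/-- Artin's relators: `σᵢ σⱼ = σⱼ σᵢ` for `i + 2 ≤ j`, and `σᵢ σⱼ σᵢ = σⱼ σᵢ σⱼ` for `j = i + 1`. -/
def rels (n : ℕ) : Set (FreeGroup (Idx n)) :=
  {w | ∃ i j : Idx n, i.1 + 2 ≤ j.1 ∧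
      w = FreeGroup.of i * FreeGroup.of j * (FreeGroup.of j * FreeGroup.of i)⁻¹} ∪
  {w | ∃ i j : Idx n, j.1 = i.1 + 1 ∧
      w = FreeGroup.of i * FreeGroup.of j * FreeGroup.of i *
        (FreeGroup.of j * FreeGroup.of i * FreeGroup.of j)⁻¹}

/-- The braid group `B_n`, by Artin's presentation. -/
abbrev Braid (n : ℕ) : Type := PresentedGroup (rels n)

/-- The Artin generator `σᵢ`, for `1 ≤ i ≤ n - 1`. Other indices do not occur below; there the
value is `1`. -/
def sigma (n i : ℕ) : Braid n :=
  if h : 1 ≤ i ∧ i < n then PresentedGroup.of (⟨i, h⟩ : Idx n) else 1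

/-- The descending product `σ_{a+m-1} ⋯ σ_{a+1} σ_a` of `m` consecutive Artin generators. -/
def descProd (n a : ℕ) : ℕ → Braid n
  | 0 => 1
  | m + 1 => sigma n (a + m) * descProd n a m

/-- `δ = σ_{n-1} ⋯ σ₂ σ₁`. -/
def delta (n : ℕ) : Braid n := descProd n 1 (n - 1)

/-- Pairs `(i, j)` with `1 ≤ i < j ≤ n`. -/
abbrev BandIdx (n : ℕ) : Type := {p : ℕ × ℕ // 1 ≤ p.1 ∧ p.1 < p.2 ∧ p.2 ≤ n}

/-- The band generator
`a_{ij} = (σ_{j-1} σ_{j-2} ⋯ σ_{i+1}) σᵢ (σ_{j-1} σ_{j-2} ⋯ σ_{i+1})⁻¹`. -/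
def band {n : ℕ} (p : BandIdx n) : Braid n :=
  descProd n (p.1.1 + 1) (p.1.2 - p.1.1 - 1) * sigma n p.1.1 *
    (descProd n (p.1.1 + 1) (p.1.2 - p.1.1 - 1))⁻¹

/-- Words in the band generators and their inverses: the letter `(p, true)` stands for the
positive band `a_p` and `(p, false)` for the negative band `a_p⁻¹`. -/
abbrev BandWord (n : ℕ) : Type := List (BandIdx n × Bool)

/-- The braid represented by a letter. -/
def letterVal {n : ℕ} (x : BandIdx n × Bool) : Braid n :=
  if x.2 then band x.1 else (band x.1)⁻¹

/-- The braid represented by a band word. -/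
def wordVal {n : ℕ} (W : BandWord n) : Braid n := (W.map letterVal).prod

/-- The number of negative bands in a band word. -/
def negCount {n : ℕ} (W : BandWord n) : ℕ := W.countP (fun x => !x.2)

/-- The negative band number `nb(β)`: the least number of negative bands in a band word
representing `β`. -/
noncomputable def nb {n : ℕ} (β : Braid n) : ℕ :=
  sInf {k | ∃ W : BandWord n, wordVal W = β ∧ negCount W = k}

/-- The length `‖β‖`: the least number of letters in a band word representing `β`. -/
noncomputable def bandLength {n : ℕ} (β : Braid n) : ℕ :=
  sInf {k | ∃ W : BandWord n, wordVal W = β ∧ W.length = k}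

/-- Every braid is represented by a band word, so both minima above are over nonempty sets. -/
theorem exists_wordVal_eq {n : ℕ} (β : Braid n) : ∃ W : BandWord n, wordVal W = β := by
  have inv_letter : ∀ x : BandIdx n × Bool, letterVal (x.1, !x.2) = (letterVal x)⁻¹ := by
    rintro ⟨p, b⟩
    cases b <;> simp [letterVal]
  have inv_word : ∀ W : BandWord n, ∃ V : BandWord n, wordVal V = (wordVal W)⁻¹ := by
    intro W
    induction W with
    | nil => exact ⟨[], by simp [wordVal]⟩
    | cons x W ih =>
      obtain ⟨V, hV⟩ := ih
      refine ⟨V ++ [(x.1, !x.2)], ?_⟩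
      simp only [wordVal, List.map_append, List.prod_append, List.map_cons, List.map_nil,
        List.prod_cons, List.prod_nil, mul_one, mul_inv_rev, inv_letter] at hV ⊢
      rw [hV]
  let H : Subgroup (Braid n) :=
    { carrier := {β | ∃ W : BandWord n, wordVal W = β}
      one_mem' := ⟨[], by simp [wordVal]⟩
      mul_mem' := by
        rintro _ _ ⟨V, rfl⟩ ⟨W, rfl⟩
        exact ⟨V ++ W, by simp [wordVal]⟩
      inv_mem' := by
        rintro _ ⟨W, rfl⟩
        exact inv_word W }
  have hH : H = ⊤ := by
    rw [eq_top_iff, ← PresentedGroup.closure_range_of (rels n), Subgroup.closure_le]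
    rintro _ ⟨i, rfl⟩
    refine ⟨[(⟨(i.1, i.1 + 1), i.2.1, Nat.lt_succ_self _, i.2.2⟩, true)], ?_⟩
    simp [wordVal, letterVal, band, descProd, sigma, i.2.1, i.2.2]
  have : β ∈ H := hH ▸ Subgroup.mem_top β
  exact this

/-- The filtration `F_i = {β | nb(β) ≤ i}` of `B_n`. -/
def filt (n i : ℕ) : Set (Braid n) := {β | nb β ≤ i}

/-- Strongly quasipositive braids: the elements of `F_0`. -/
def IsSQP {n : ℕ} (β : Braid n) : Prop := β ∈ filt n 0

/-- Almost strongly quasipositive braids: the elements of `F_1`. -/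
def IsASQP {n : ℕ} (β : Braid n) : Prop := β ∈ filt n 1

/-- `V ≤ W`: one has `W = P V Q` for some `P, Q` in `SQP(n)`. -/
def BLE {n : ℕ} (V W : Braid n) : Prop :=
  ∃ P Q : Braid n, IsSQP P ∧ IsSQP Q ∧ W = P * V * Q

/-- `inf(β) = max {r ∈ ℤ | δ^r ≤ β}`. For `n ≥ 2` the set is nonempty and bounded above, so the
supremum is a maximum. -/
noncomputable def binf {n : ℕ} (β : Braid n) : ℤ := sSup {r : ℤ | BLE (delta n ^ r) β}

/-- `sup(β) = min {s ∈ ℤ | β ≤ δ^s}`. For `n ≥ 2` the set is nonempty and bounded below, so the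
infimum is a minimum. -/
noncomputable def bsup {n : ℕ} (β : Braid n) : ℤ := sInf {s : ℤ | BLE β (delta n ^ s)}

/-- The canonical length `ℓ(β) = sup(β) - inf(β)`. -/
noncomputable def canLength {n : ℕ} (β : Braid n) : ℤ := bsup β - binf β

/-- Canonical factors: braids `A` with `e ≤ A ≤ δ`. -/
def IsCnFct {n : ℕ} (A : Braid n) : Prop := BLE 1 A ∧ BLE A (delta n)

/-- `A ≺ B`: one has `A Q = B` for some canonical factor `Q`. -/
def Prec {n : ℕ} (A B : Braid n) : Prop := ∃ Q : Braid n, IsCnFct Q ∧ A * Q = B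

/-- `A B ⇒ A' B'`: the two products are the same braid and `A ≺ A'`. -/
def MoreLeftWeighted {n : ℕ} (A B A' B' : Braid n) : Prop := A * B = A' * B' ∧ Prec A A'

/-- `A B` is maximally left-weighted: the only canonical factors `A', B'` with `A B ⇒ A' B'`
are `A' = A`, `B' = B`. -/
def MaxLeftWeighted {n : ℕ} (A B : Braid n) : Prop :=
  ∀ A' B' : Braid n, IsCnFct A' → IsCnFct B' → MoreLeftWeighted A B A' B' → A' = A ∧ B' = B

/-- `δ^r A₁ ⋯ A_k` is the left-canonical form of `β`, where `L = [A₁, …, A_k]`. -/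
structure IsLCF {n : ℕ} (β : Braid n) (r : ℤ) (L : List (Braid n)) : Prop where
  cnFct : ∀ A ∈ L, IsCnFct A ∧ A ≠ 1 ∧ A ≠ delta n
  eq_prod : β = delta n ^ r * L.prod
  chain : L.IsChain MaxLeftWeighted

/-- The super summit set of the conjugacy class of `β`: the conjugates of `β` whose canonical
length is minimal among all conjugates of `β`. -/
def SSS {n : ℕ} (β : Braid n) : Set (Braid n) :=
  {β' | IsConj β β' ∧ ∀ γ : Braid n, IsConj β γ → canLength β' ≤ canLength γ}

end BraidGrp

/-! The positive half is a computation with exponent sums. If a canonical factor `A` has length `n -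
2`, then `A⁻¹δ` is SQP of exponent sum `1`, hence a single band `a`, and `A = δa⁻¹`. So `β' =
(δ⁻¹Pδ) a⁻¹ Q` with `P, Q` SQP, and conjugation by `δ` preserves SQP braids.

For the negative half, write `β' = δ⁻¹Y` and suppose it is conjugate to an SQP braid `z`. Since
`δ^n` is central, the conjugator can be made SQP: `c δ⁻¹ Y = z c`. Let `H` be the greatest canonical
factor dividing `Y = H Y₁` on the left. Now `δ` divides `(δcδ⁻¹)Y`, hence already `(δcδ⁻¹)H`, so `c'
= cδ⁻¹H` is SQP. It conjugates the cycled braid `δ⁻¹(δY₁δ⁻¹)H` to the same `z`, the cycled positive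
part needs no more canonical factors than `Y`, and `c'` has smaller exponent sum than `c` unless `H
= δ`. After finitely many cyclings the braid is SQP and sup has not grown (`exists_conj_cycling`).
As inf has risen from `-1` to at least `0`, the canonical length has dropped, against minimality in
the super summit set (`not_isConj_sqp`).

This rests on the Garside structure of the SQP monoid. The interval below an `n`-cycle in the
absolute order on permutations is a lattice; the monoid it generates has greatest simple divisors,
is left cancellative, and embeds in a group (`exists_embedding`). The Birman–Ko–Lee relations hold
for bands, which gives a map from this monoid to `B_n`; mapping `B_n` back to that group shows it to
be injective, with image the SQP braids (`exists_dualMon_hom`). -/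

/-- A conjugation-invariant length function on a group. -/
structure ConjLength (W : Type*) [Group W] where
  /-- the length -/
  len : W → ℕ
  len_one : len 1 = 0
  eq_one : ∀ x, len x = 0 → x = 1
  len_mul_le : ∀ x y, len (x * y) ≤ len x + len y
  len_conj : ∀ x y, len (x * y * x⁻¹) = len y

/-! ### Meets and reduced words from local conditions on atoms. -/

namespace ConjLength

variable {W : Type*} [Group W] (K : ConjLength W)

/-- `x ≤ y` when `y = x * z` with lengths adding up. -/
def le (x y : W) : Prop := K.len x + K.len (x⁻¹ * y) = K.len y

variable {K} {x y z u : W}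

theorem le_of_len_le (h : K.len x + K.len (x⁻¹ * y) ≤ K.len y) : K.le x y := by
  have := K.len_mul_le x (x⁻¹ * y)
  rw [mul_inv_cancel_left] at this
  exact le_antisymm h this

theorem le_refl (x : W) : K.le x x := by simp [le, K.len_one]

theorem one_le (x : W) : K.le 1 x := by simp [le, K.len_one]

theorem le.len_le (h : K.le x y) : K.len x ≤ K.len y := by
  unfold le at h; omega

theorem le.eq_of_len (h : K.le x y) (hl : K.len y ≤ K.len x) : x = y := by
  unfold le at h
  have := K.eq_one (x⁻¹ * y) (by omega)
  exact (inv_mul_eq_one.1 this)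

theorem le.trans (h : K.le x y) (h' : K.le y z) : K.le x z := by
  apply le_of_len_le
  have := K.len_mul_le (x⁻¹ * y) (y⁻¹ * z)
  rw [mul_assoc, mul_inv_cancel_left] at this
  unfold le at h h'
  omega

theorem le.antisymm (h : K.le x y) (h' : K.le y x) : x = y := h.eq_of_len h'.len_le

/-- Conjugation invariance enters here: `(x⁻¹y)⁻¹y` is a conjugate of `x`, so right factors of `y`
are also left factors. -/
theorem le.inv_mul_le (h : K.le x y) : K.le (x⁻¹ * y) y := by
  unfold le at *
  have : (x⁻¹ * y)⁻¹ * y = y⁻¹ * x * (y⁻¹)⁻¹ := by group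
  rw [this, K.len_conj]
  omega

theorem le.inv_mul_mono (h : K.le x y) (h' : K.le y z) : K.le (x⁻¹ * y) (x⁻¹ * z) := by
  have h2 := h.trans h'
  unfold le at *
  have : (x⁻¹ * y)⁻¹ * (x⁻¹ * z) = y⁻¹ * z := by group
  rw [this]
  omega

theorem le.len_mul (h : K.le x z) (h' : K.le u (x⁻¹ * z)) : K.len (x * u) = K.len x + K.len u := by
  have h1 := K.len_mul_le x u
  have h2 := K.len_mul_le (x * u) (u⁻¹ * (x⁻¹ * z))
  have : x * u * (u⁻¹ * (x⁻¹ * z)) = z := by group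
  rw [this] at h2
  unfold le at h h'
  omega

theorem le.le_mul (h : K.le x z) (h' : K.le u (x⁻¹ * z)) : K.le x (x * u) := by
  unfold le
  rw [inv_mul_cancel_left, h.len_mul h']

theorem le.mul_le (h : K.le x z) (h' : K.le u (x⁻¹ * z)) : K.le (x * u) z := by
  have h1 := h.len_mul h'
  unfold le at *
  have : (x * u)⁻¹ * z = u⁻¹ * (x⁻¹ * z) := by group
  rw [this]
  omega

theorem le.of_mul_le (h : K.le x (x * u)) (h' : K.le (x * u) z) : K.le u (x⁻¹ * z) := by
  have := h.inv_mul_mono h'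
  rwa [inv_mul_cancel_left] at this

theorem le.mul_mono (h : K.le x z) (hu : K.le u y) (h' : K.le y (x⁻¹ * z)) :
    K.le (x * u) (x * y) := by
  have h1 := h.len_mul h'
  have h2 := h.len_mul (hu.trans h')
  unfold le at *
  have : (x * u)⁻¹ * (x * y) = u⁻¹ * y := by group
  rw [this]
  omega

theorem le_mul_iff : K.le x (x * y) ↔ K.len x + K.len y = K.len (x * y) := by
  unfold le; rw [inv_mul_cancel_left]

section Atoms

variable (K) {ι : Type*} (c : W) (a : ι → W) {N : Type*} [Monoid N] (b : ι → N)

/-- `p` and `q` have a common upper bound of length two which lies below every element of the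
interval above both, and the corresponding relation holds for `b`. -/
def Joined (p q : ι) : Prop :=
  ∃ r s, a p * a r = a q * a s ∧ b p * b r = b q * b s ∧
    K.len (a p * a r) = 2 ∧ ∀ w, K.le w c → K.le (a p) w → K.le (a q) w → K.le (a p * a r) w

variable {K c a b}

theorem Joined.symm {p q : ι} (h : Joined K c a b p q) : Joined K c a b q p := by
  obtain ⟨r, s, h1, h2, h3, h4⟩ := h
  exact ⟨s, r, h1.symm, h2.symm, h1 ▸ h3, fun w hw hp hq => h1 ▸ h4 w hw hq hp⟩

variable (K c a b)

/-- The local conditions on the atoms of an interval which make it a lattice, and make `b`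
extend to a multiplicative map on the interval. -/
structure AtomSystem : Prop where
  len_atom : ∀ i, K.len (a i) = 1
  exists_atom : ∀ w, K.le w c → w ≠ 1 → ∃ i, K.le (a i) w
  -- The last alternative serves crossing transpositions, which are connected only through a third
  -- atom.
  joined : ∀ i j, i = j ∨ Joined K c a b i j ∨ ∃ d,
    (∀ w, K.le w c → K.le (a i) w → K.le (a j) w → K.le (a d) w) ∧
      Joined K c a b i d ∧ Joined K c a b d j

variable {K c a b}

/-- Any two common lower bounds above `z` of `x` and `y` are bounded by a common lower bound. -/
theorem AtomSystem.exists_bound (hA : AtomSystem K c a b) (hx : K.le x c) (hy : K.le y c) :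
    ∀ k : ℕ, ∀ z p q, K.len c ≤ K.len z + k → K.le z p → K.le z q → K.le p x → K.le p y →
      K.le q x → K.le q y → ∃ r, K.le r x ∧ K.le r y ∧ K.le p r ∧ K.le q r := by
  -- Induction on the colength of `z`, as in Newman's lemma: atoms above `z` and below `p` or `q`
  -- are connected through `Joined` pairs, whose joins remain below both `x` and `y`.
  intro k
  induction k with
  | zero =>
    intro z p q hk hzp hzq hpx hpy hqx hqy
    have h1 := (hpx.trans hx).len_le
    have h2 := hzp.eq_of_len (by omega)
    exact ⟨q, hqx, hqy, h2 ▸ hzq, K.le_refl q⟩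
  | succ k ih =>
    intro z p q hk hzp hzq hpx hpy hqx hqy
    by_cases hp : z⁻¹ * p = 1
    · rw [inv_mul_eq_one] at hp
      exact ⟨q, hqx, hqy, hp ▸ hzq, K.le_refl q⟩
    by_cases hq : z⁻¹ * q = 1
    · rw [inv_mul_eq_one] at hq
      exact ⟨p, hpx, hpy, K.le_refl p, hq ▸ hzp⟩
    have hzx := hzp.trans hpx
    have hzy := hzp.trans hpy
    have sub : ∀ {v w}, K.le z v → K.le v w → K.le w c → K.le (z⁻¹ * v) c := fun h1 h2 h3 =>
      (h1.inv_mul_le).trans (h2.trans h3)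
    obtain ⟨i, hi⟩ := hA.exists_atom _ (sub hzp hpx hx) hp
    obtain ⟨j, hj⟩ := hA.exists_atom _ (sub hzq hqx hx) hq
    -- common lower bounds strictly above `z` sharing an atom can be joined
    have step : ∀ i, ∀ p q, K.le (a i) (z⁻¹ * p) → K.le (a i) (z⁻¹ * q) → K.le z p → K.le z q →
        K.le p x → K.le p y → K.le q x → K.le q y →
        ∃ r, K.le r x ∧ K.le r y ∧ K.le p r ∧ K.le q r := by
      intro i p q hip hiq hzp hzq
      refine ih (z * a i) p q ?_ (hzp.mul_le hip) (hzq.mul_le hiq)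
      rw [hzp.len_mul hip, hA.len_atom]
      omega
    have key : ∀ i j, Joined K c a b i j → ∀ p q, K.le (a i) (z⁻¹ * p) → K.le (a j) (z⁻¹ * q) →
        K.le z p → K.le z q → K.le p x → K.le p y → K.le q x → K.le q y →
        ∃ r, K.le r x ∧ K.le r y ∧ K.le p r ∧ K.le q r := by
      intro i j hij p q hip hjq hzp hzq hpx hpy hqx hqy
      obtain ⟨r, s, h1, -, h3, h4⟩ := hij
      have hjx := h4 _ (sub hzx (K.le_refl x) hx) (hip.trans (hzp.inv_mul_mono hpx))
        (hjq.trans (hzq.inv_mul_mono hqx))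
      have hjy := h4 _ (sub hzy (K.le_refl y) hy) (hip.trans (hzp.inv_mul_mono hpy))
        (hjq.trans (hzq.inv_mul_mono hqy))
      have hzj := hzx.le_mul hjx
      have hi : K.le (a i) (z⁻¹ * (z * (a i * a r))) := by
        rw [inv_mul_cancel_left]; unfold le; rw [inv_mul_cancel_left, h3, hA.len_atom, hA.len_atom]
      have hj : K.le (a j) (z⁻¹ * (z * (a i * a r))) := by
        rw [inv_mul_cancel_left]; unfold le
        rw [h3, h1, inv_mul_cancel_left, hA.len_atom, hA.len_atom]
      obtain ⟨u, hu1, hu2, hu3, hu4⟩ := step i p _ hip hi hzp hzj hpx hpy (hzx.mul_le hjx)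
        (hzy.mul_le hjy)
      obtain ⟨v, hv1, hv2, hv3, hv4⟩ := step j q _ hjq hj hzq hzj hqx hqy (hzx.mul_le hjx)
        (hzy.mul_le hjy)
      obtain ⟨t, ht1, ht2, ht3, ht4⟩ := step i u v (hi.trans (hzj.inv_mul_mono hu4))
        (hi.trans (hzj.inv_mul_mono hv4)) (hzp.trans hu3) (hzq.trans hv3) hu1 hu2 hv1 hv2
      exact ⟨t, ht1, ht2, hu3.trans ht3, hv3.trans ht4⟩
    rcases hA.joined i j with rfl | h | ⟨d, hd, h1, h2⟩
    · exact step i p q hi hj hzp hzq hpx hpy hqx hqy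
    · exact key i j h p q hi hj hzp hzq hpx hpy hqx hqy
    · have hdx := hd _ (sub hzx (K.le_refl x) hx) (hi.trans (hzp.inv_mul_mono hpx))
        (hj.trans (hzq.inv_mul_mono hqx))
      have hdy := hd _ (sub hzy (K.le_refl y) hy) (hi.trans (hzp.inv_mul_mono hpy))
        (hj.trans (hzq.inv_mul_mono hqy))
      have hzd := hzx.le_mul hdx
      have hdd : K.le (a d) (z⁻¹ * (z * a d)) := by
        rw [inv_mul_cancel_left]; exact K.le_refl _
      obtain ⟨u, hu1, hu2, hu3, hu4⟩ := key i d h1 p _ hi hdd hzp hzd hpx hpy (hzx.mul_le hdx)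
        (hzy.mul_le hdy)
      obtain ⟨v, hv1, hv2, hv3, hv4⟩ := key d j h2 _ q hdd hj hzd hzq (hzx.mul_le hdx)
        (hzy.mul_le hdy) hqx hqy
      obtain ⟨t, ht1, ht2, ht3, ht4⟩ := step d u v (hdd.trans (hzd.inv_mul_mono hu4))
        (hdd.trans (hzd.inv_mul_mono hv3)) (hzp.trans hu3) (hzd.trans hv3) hu1 hu2 hv1 hv2
      exact ⟨t, ht1, ht2, hu3.trans ht3, hv4.trans ht4⟩

/-- A common lower bound of maximal length is the greatest one, since `exists_bound` places it and
any other one below a third. -/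
theorem AtomSystem.exists_meet (hA : AtomSystem K c a b) (hx : K.le x c) (hy : K.le y c) :
    ∃ m, K.le m x ∧ K.le m y ∧ ∀ z, K.le z x → K.le z y → K.le z m := by
  have hne : {k | ∃ m, K.le m x ∧ K.le m y ∧ K.len m = k}.Nonempty :=
    ⟨_, 1, K.one_le x, K.one_le y, rfl⟩
  have hbdd : BddAbove {k | ∃ m, K.le m x ∧ K.le m y ∧ K.len m = k} :=
    ⟨K.len x, by rintro _ ⟨m, h1, -, rfl⟩; exact h1.len_le⟩
  obtain ⟨m, hmx, hmy, hm⟩ := Nat.sSup_mem hne hbdd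
  refine ⟨m, hmx, hmy, fun z hzx hzy => ?_⟩
  obtain ⟨r, hr1, hr2, hr3, hr4⟩ := hA.exists_bound hx hy (K.len c) 1 m z (by omega) (K.one_le m)
    (K.one_le z) hmx hmy hzx hzy
  have := le_csSup hbdd ⟨r, hr1, hr2, rfl⟩
  rw [← hm] at this
  rwa [hr3.eq_of_len this]

variable (K a) in
/-- `l` is a word of minimal length in the atoms for `w`. -/
def Reduced (l : List ι) (w : W) : Prop := (l.map a).prod = w ∧ l.length = K.len w

theorem AtomSystem.exists_reduced (hA : AtomSystem K c a b) :
    ∀ k : ℕ, ∀ w, K.le w c → K.len w = k → ∃ l, Reduced K a l w := by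
  intro k
  induction k with
  | zero => exact fun w _ h => ⟨[], by simp [K.eq_one w h], by simp [h]⟩
  | succ k ih =>
    intro w hw hk
    obtain ⟨i, hi⟩ := hA.exists_atom w hw (by rintro rfl; rw [K.len_one] at hk; omega)
    have hi' := hi
    rw [le, hA.len_atom] at hi'
    obtain ⟨l, hl, hl'⟩ := ih ((a i)⁻¹ * w) (hi.inv_mul_le.trans hw) (by omega)
    exact ⟨i :: l, by simp [hl], by simp only [List.length_cons]; omega⟩

theorem Reduced.cons (hA : AtomSystem K c a b) {i : ι} {l : List ι} {w : W}
    (h : Reduced K a (i :: l) w) : K.le (a i) w ∧ Reduced K a l ((a i)⁻¹ * w) := by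
  obtain ⟨h1, h2⟩ := h
  have hl : (l.map a).prod = (a i)⁻¹ * w := by rw [← h1]; simp
  have hle : ∀ l : List ι, K.len (l.map a).prod ≤ l.length := by
    intro l
    induction l with
    | nil => simp [K.len_one]
    | cons j l ih =>
      have := K.len_mul_le (a j) (l.map a).prod
      rw [hA.len_atom] at this
      simp only [List.map_cons, List.prod_cons, List.length_cons]
      omega
  have h3 := hle l
  rw [hl] at h3
  simp only [List.length_cons] at h2
  have : K.le (a i) w := le_of_len_le (by rw [hA.len_atom]; omega)
  refine ⟨this, hl, ?_⟩
  rw [le, hA.len_atom] at this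
  omega

/-- An analogue of Matsumoto's theorem: the first letters of two reduced words are linked through
`Joined` atoms, the join of such a pair extends to a reduced word, and `b` respects the exchange. -/
theorem AtomSystem.reduced_unique (hA : AtomSystem K c a b) :
    ∀ k : ℕ, ∀ w, K.le w c → K.len w = k → ∀ l l', Reduced K a l w → Reduced K a l' w →
      (l.map b).prod = (l'.map b).prod := by
  intro k
  induction k using Nat.strong_induction_on with
  | _ k ih =>
  intro w hw hk l l' hl hl'
  match l, l' with
  | [], [] => rfl
  | [], j :: l' => have := hl.2; have := hl'.2; simp only [List.length_cons, List.length_nil] at *; omega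
  | i :: l, [] => have := hl.2; have := hl'.2; simp only [List.length_cons, List.length_nil] at *; omega
  | i :: l, j :: l' =>
    have step : ∀ i l l', Reduced K a (i :: l) w → Reduced K a (i :: l') w →
        ((i :: l).map b).prod = ((i :: l').map b).prod := by
      intro i l l' hl hl'
      obtain ⟨h1, h2⟩ := hl.cons hA
      obtain ⟨-, h3⟩ := hl'.cons hA
      have h4 := h1
      rw [le, hA.len_atom] at h4
      simp only [List.map_cons, List.prod_cons]
      rw [ih _ (by omega) _ (h1.inv_mul_le.trans hw) rfl _ _ h2 h3]
    have key : ∀ i j, Joined K c a b i j → ∀ l l', Reduced K a (i :: l) w →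
        Reduced K a (j :: l') w → ((i :: l).map b).prod = ((j :: l').map b).prod := by
      intro i j ⟨r, s, h1, h2, h3, h4⟩ l l' hl hl'
      have h5 := h4 w hw (hl.cons hA).1 (hl'.cons hA).1
      obtain ⟨m, hm1, hm2⟩ := hA.exists_reduced _ ((a i * a r)⁻¹ * w) (h5.inv_mul_le.trans hw) rfl
      rw [le, h3] at h5
      have e1 : Reduced K a (i :: r :: m) w := by
        refine ⟨by simp [hm1, ← mul_assoc], ?_⟩
        simp only [List.length_cons]; omega
      have e2 : Reduced K a (j :: s :: m) w := by
        refine ⟨by simp [hm1, h1, ← mul_assoc], ?_⟩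
        simp only [List.length_cons]; omega
      rw [step i l _ hl e1, step j l' _ hl' e2]
      simp [← mul_assoc, h2]
    rcases hA.joined i j with rfl | h | ⟨d, hd, h1, h2⟩
    · exact step i l l' hl hl'
    · exact key i j h l l' hl hl'
    · have hdw := hd w hw (hl.cons hA).1 (hl'.cons hA).1
      obtain ⟨m, hm1, hm2⟩ := hA.exists_reduced _ ((a d)⁻¹ * w) (hdw.inv_mul_le.trans hw) rfl
      rw [le, hA.len_atom] at hdw
      have e1 : Reduced K a (d :: m) w := by
        refine ⟨by simp [hm1], ?_⟩
        simp only [List.length_cons]; omega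
      rw [key i d h1 l m hl e1, key d j h2 m l' e1 hl']

/-- Taken with `b` the bands, this `f` defines the map from the dual monoid to the braid group. -/
theorem AtomSystem.exists_lift (hA : AtomSystem K c a b) :
    ∃ f : W → N, (∀ l w, K.le w c → Reduced K a l w → f w = (l.map b).prod) ∧
      ∀ x y, K.le (x * y) c → K.le x (x * y) → f x * f y = f (x * y) := by
  classical
  have hex : ∀ w, ∃ v : N, K.le w c → ∀ l, Reduced K a l w → v = (l.map b).prod := by
    intro w
    by_cases hw : K.le w c
    · obtain ⟨l, hl⟩ := hA.exists_reduced _ w hw rfl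
      exact ⟨(l.map b).prod, fun _ l' hl' => hA.reduced_unique _ w hw rfl l l' hl hl'⟩
    · exact ⟨1, fun h => absurd h hw⟩
  choose f hf using hex
  refine ⟨f, fun l w hw hl => hf w hw l hl, fun x y hxy hx => ?_⟩
  have hx' := hx.trans hxy
  have hy' := hx.inv_mul_le.trans hxy
  rw [inv_mul_cancel_left] at hy'
  obtain ⟨l, hl⟩ := hA.exists_reduced _ x hx' rfl
  obtain ⟨m, hm⟩ := hA.exists_reduced _ y hy' rfl
  rw [hf x hx' l hl, hf y hy' m hm, hf _ hxy (l ++ m) ⟨by simp [hl.1, hm.1], ?_⟩]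
  · simp
  · rw [List.length_append, hl.2, hm.2, ← le_mul_iff.1 hx]

end Atoms

end ConjLength

/-! ### Garside theory of the monoid generated by an interval. -/

/-- An interval `[1, top]` for the order of a conjugation-invariant length, with binary meets. -/
structure IntervalLattice (W : Type*) [Group W] where
  /-- the length function -/
  K : ConjLength W
  /-- the top of the interval -/
  top : W
  exists_meet : ∀ x y, K.le x top → K.le y top →
    ∃ m, K.le m x ∧ K.le m y ∧ ∀ z, K.le z x → K.le z y → K.le z m

namespace IntervalLattice

universe u

open ConjLength

variable {W : Type*} [Group W] (I : IntervalLattice W)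

/-- The elements of the interval. -/
abbrev Simple := {w : W // I.K.le w I.top}

/-- The defining relations of the interval monoid. -/
inductive Rel : FreeMonoid I.Simple → FreeMonoid I.Simple → Prop
  | one : Rel (FreeMonoid.of ⟨1, I.K.one_le _⟩) 1
  | mul (s t u : I.Simple) (h : s.1 * t.1 = u.1) (hle : I.K.le s.1 u.1) :
      Rel (FreeMonoid.of s * FreeMonoid.of t) (FreeMonoid.of u)

/-- The monoid generated by an interval, with the products inside the interval as relations. -/
abbrev Mon := PresentedMonoid I.Rel

/-- The generator of the interval monoid given by an element of the interval. -/
def of (s : I.Simple) : I.Mon := PresentedMonoid.of I.Rel s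

theorem of_one : I.of ⟨1, I.K.one_le _⟩ = 1 := PresentedMonoid.mk_eq_mk_of_rel Rel.one

variable {I}

theorem of_mul {s t u : I.Simple} (h : s.1 * t.1 = u.1) (hle : I.K.le s.1 u.1) :
    I.of s * I.of t = I.of u := PresentedMonoid.mk_eq_mk_of_rel (Rel.mul s t u h hle)

theorem of_mul_inv {s u : I.Simple} (hle : I.K.le s.1 u.1) :
    I.of s * I.of ⟨s.1⁻¹ * u.1, hle.inv_mul_le.trans u.2⟩ = I.of u :=
  of_mul (mul_inv_cancel_left _ _) hle

@[elab_as_elim]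
theorem Mon.induction {P : I.Mon → Prop} (one : P 1) (mul : ∀ s x, P x → P (I.of s * x)) (x : I.Mon) :
    P x := by
  induction x using PresentedMonoid.inductionOn with
  | h w =>
    induction w using FreeMonoid.inductionOn' with
    | one => exact one
    | of_mul s w ih => exact mul s _ ih

variable (I) in
/-- The complement of an element of the interval. -/
def compl (s : I.Simple) : I.Simple := ⟨s.1⁻¹ * I.top, s.2.inv_mul_le⟩

/-- The part of `h` which can be absorbed into `s`. -/
noncomputable def cut (s h : I.Simple) : W :=
  (I.exists_meet (I.compl s).1 h.1 (I.compl s).2 h.2).choose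

theorem cut_le_compl (s h : I.Simple) : I.K.le (cut s h) (s.1⁻¹ * I.top) :=
  (I.exists_meet (I.compl s).1 h.1 (I.compl s).2 h.2).choose_spec.1

theorem cut_le (s h : I.Simple) : I.K.le (cut s h) h.1 :=
  (I.exists_meet (I.compl s).1 h.1 (I.compl s).2 h.2).choose_spec.2.1

theorem le_cut {s h : I.Simple} {z : W} (h1 : I.K.le z (s.1⁻¹ * I.top)) (h2 : I.K.le z h.1) :
    I.K.le z (cut s h) :=
  (I.exists_meet (I.compl s).1 h.1 (I.compl s).2 h.2).choose_spec.2.2 z h1 h2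

/-- The head of `s * h`. -/
noncomputable def headMul (s h : I.Simple) : I.Simple :=
  ⟨s.1 * cut s h, s.2.mul_le (cut_le_compl s h)⟩

/-- The tail of `s * h`. -/
noncomputable def tailMul (s h : I.Simple) : I.Simple :=
  ⟨(cut s h)⁻¹ * h.1, (cut_le s h).inv_mul_le.trans h.2⟩

/-- Cocycle identity behind the normal form: absorbing from `k` into `t` and then into `s` takes as
much as absorbing into `st` at once. Both sides divide each other by the universal property of the
meet. -/
theorem cut_mul {s t u : I.Simple} (h : s.1 * t.1 = u.1) (hle : I.K.le s.1 u.1) (k : I.Simple) :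
    cut s (headMul t k) = t.1 * cut u k := by
  have ht : I.K.le t.1 (s.1⁻¹ * I.top) := by
    apply ConjLength.le.of_mul_le <;> rw [h]
    exacts [hle, u.2]
  have hu : u.1⁻¹ * I.top = t.1⁻¹ * (s.1⁻¹ * I.top) := by rw [← h]; group
  have ht1 : I.K.le t.1 (cut s (headMul t k)) :=
    le_cut ht (t.2.le_mul (cut_le_compl t k))
  have hm := (cut_le s (headMul t k))
  have h2 : I.K.le (t.1⁻¹ * cut s (headMul t k)) (cut t k) := by
    have := ht1.inv_mul_mono hm
    simpa [headMul] using this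
  have h3 : I.K.le (t.1⁻¹ * cut s (headMul t k)) (cut u k) := by
    apply le_cut _ (h2.trans (cut_le t k))
    rw [hu]
    exact ht1.inv_mul_mono (cut_le_compl _ _)
  have h4 := cut_le_compl u k
  rw [hu] at h4
  have h5 : I.K.le (t.1 * cut u k) (s.1⁻¹ * I.top) := ht.mul_le h4
  have h6 : I.K.le t.1 (t.1 * cut u k) := ht.le_mul h4
  have h7 : I.K.le (cut u k) (t.1⁻¹ * I.top) :=
    ConjLength.le.of_mul_le h6 (h5.trans s.2.inv_mul_le)
  have h8 : I.K.le (cut u k) (cut t k) := le_cut h7 (cut_le u k)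
  have h9 : I.K.le (t.1 * cut u k) (cut s (headMul t k)) :=
    le_cut h5 (t.2.mul_mono h8 (cut_le_compl t k))
  have h10 : I.K.le (cut u k) (t.1⁻¹ * cut s (headMul t k)) := ConjLength.le.of_mul_le h6 h9
  rw [h10.antisymm h3, mul_inv_cancel_left]

theorem headMul_mul {s t u : I.Simple} (h : s.1 * t.1 = u.1) (hle : I.K.le s.1 u.1)
    (k : I.Simple) : headMul s (headMul t k) = headMul u k := by
  apply Subtype.ext
  show s.1 * cut s (headMul t k) = u.1 * cut u k
  rw [cut_mul h hle, ← h, mul_assoc]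

theorem tailMul_mul {s t u : I.Simple} (h : s.1 * t.1 = u.1) (hle : I.K.le s.1 u.1)
    (k : I.Simple) : I.of (tailMul s (headMul t k)) * I.of (tailMul t k) = I.of (tailMul u k) := by
  have e : (cut s (headMul t k))⁻¹ * (headMul t k).1 = (cut u k)⁻¹ * cut t k := by
    rw [cut_mul h hle]; simp [headMul, mul_assoc]
  have h8 : I.K.le (cut u k) (cut t k) := by
    have h1 := cut_le s (headMul t k)
    rw [cut_mul h hle] at h1
    have ht : I.K.le t.1 (s.1⁻¹ * I.top) := by
      apply ConjLength.le.of_mul_le <;> rw [h]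
      exacts [hle, u.2]
    have h4 := cut_le_compl u k
    rw [show u.1⁻¹ * I.top = t.1⁻¹ * (s.1⁻¹ * I.top) by rw [← h]; group] at h4
    have := ConjLength.le.of_mul_le (ht.le_mul h4) h1
    simpa [headMul] using this
  apply of_mul
  · show (cut s (headMul t k))⁻¹ * (headMul t k).1 * ((cut t k)⁻¹ * k.1) = (cut u k)⁻¹ * k.1
    rw [e]; group
  · show I.K.le ((cut s (headMul t k))⁻¹ * (headMul t k).1) ((cut u k)⁻¹ * k.1)
    rw [e]
    exact h8.inv_mul_mono (cut_le t k)

theorem cut_one (h : I.Simple) : cut ⟨1, I.K.one_le _⟩ h = h.1 := by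
  apply (cut_le _ _).antisymm
  exact le_cut (by simpa using h.2) (I.K.le_refl _)

theorem cut_of_one (s : I.Simple) : cut s ⟨1, I.K.one_le _⟩ = 1 :=
  (cut_le _ _).antisymm (I.K.one_le _)

variable (I) in
/-- The action of a generator on pairs consisting of a head and a tail. -/
noncomputable def actGen (s : I.Simple) : Function.End (I.Simple × I.Mon) :=
  fun p => (headMul s p.1, I.of (tailMul s p.1) * p.2)

variable (I) in
/-- The action of the interval monoid on pairs consisting of a head and a tail. -/
noncomputable def act : I.Mon →* Function.End (I.Simple × I.Mon) :=
  -- A pair records a greatest simple divisor and the remainder. That the action respects the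
  -- relations makes heads and tails independent of the word.
  PresentedMonoid.lift (actGen I) (by
    intro x y h
    cases h with
    | one =>
      rw [FreeMonoid.lift_eval_of, map_one]
      funext ⟨h, m⟩
      refine Prod.ext (Subtype.ext ?_) ?_
      · show 1 * cut _ h = h.1
        rw [cut_one, one_mul]
      · show I.of (tailMul _ h) * m = m
        have : tailMul ⟨1, I.K.one_le _⟩ h = ⟨1, I.K.one_le _⟩ := by
          apply Subtype.ext
          simp [tailMul, cut_one]
        rw [this, of_one, one_mul]
    | mul s t u h hle =>
      rw [map_mul, FreeMonoid.lift_eval_of, FreeMonoid.lift_eval_of, FreeMonoid.lift_eval_of]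
      funext ⟨k, m⟩
      refine Prod.ext (headMul_mul h hle k) ?_
      show I.of (tailMul s (headMul t k)) * (I.of (tailMul t k) * m) = I.of (tailMul u k) * m
      rw [← mul_assoc, tailMul_mul h hle])

/-- The head of an element: its greatest divisor in the interval. -/
noncomputable def head (x : I.Mon) : I.Simple := (act I x (⟨1, I.K.one_le _⟩, 1)).1

/-- The tail of an element: what remains after removing the head. -/
noncomputable def tail (x : I.Mon) : I.Mon := (act I x (⟨1, I.K.one_le _⟩, 1)).2

theorem head_one : head (1 : I.Mon) = ⟨1, I.K.one_le _⟩ := by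
  simp only [head, map_one]; rfl

theorem tail_one : tail (1 : I.Mon) = 1 := by
  simp only [tail, map_one]; rfl

theorem head_of_mul (s : I.Simple) (x : I.Mon) : head (I.of s * x) = headMul s (head x) := by
  simp only [head, map_mul]; rfl

theorem tail_of_mul (s : I.Simple) (x : I.Mon) :
    tail (I.of s * x) = I.of (tailMul s (head x)) * tail x := by
  simp only [tail, map_mul]; rfl

theorem of_cut_mul (s h : I.Simple) :
    I.of ⟨cut s h, (cut_le s h).trans h.2⟩ * I.of (tailMul s h) = I.of h :=
  of_mul_inv (s := ⟨cut s h, (cut_le s h).trans h.2⟩) (cut_le s h)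

theorem of_mul_cut (s h : I.Simple) :
    I.of s * I.of ⟨cut s h, (cut_le s h).trans h.2⟩ = I.of (headMul s h) :=
  of_mul rfl (s.2.le_mul (cut_le_compl s h))

theorem head_mul_tail (x : I.Mon) : I.of (head x) * tail x = x := by
  induction x using Mon.induction with
  | one => rw [head_one, tail_one, of_one, one_mul]
  | mul s x ih =>
    rw [head_of_mul, tail_of_mul, ← of_mul_cut, ← mul_assoc, mul_assoc (I.of s), of_cut_mul,
      mul_assoc, ih]

theorem head_of (h : I.Simple) : head (I.of h) = h := by
  rw [← mul_one (I.of h), head_of_mul, head_one]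
  apply Subtype.ext
  show h.1 * cut _ _ = h.1
  rw [cut_of_one, mul_one]

theorem head_mul (x y : I.Mon) : head (x * y) = head (x * I.of (head y)) := by
  induction x using Mon.induction with
  | one => rw [one_mul, one_mul, head_of]
  | mul s x ih => rw [mul_assoc, mul_assoc, head_of_mul, head_of_mul, ih]

/-- Removing a generator from the left of a product with a given head and tail. -/
theorem eq_cut_mul_tail (s : I.Simple) (x : I.Mon) :
    x = I.of ⟨cut s (head x), (cut_le s _).trans (head x).2⟩ * tail (I.of s * x) := by
  rw [tail_of_mul, ← mul_assoc, of_cut_mul, head_mul_tail]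

/-- The head of `s x` is `s` times the cut, so `s x` determines the cut and the tail, and these
recover `x`. -/
theorem of_mul_left_cancel {s : I.Simple} {x y : I.Mon} (h : I.of s * x = I.of s * y) : x = y := by
  have h1 : headMul s (head x) = headMul s (head y) := by rw [← head_of_mul, ← head_of_mul, h]
  have h2 : cut s (head x) = cut s (head y) := mul_left_cancel (congrArg Subtype.val h1)
  rw [eq_cut_mul_tail s x, eq_cut_mul_tail s y, h]
  simp only [h2]

theorem left_cancel {x y z : I.Mon} (h : z * x = z * y) : x = y := by
  induction z using Mon.induction with
  | one => simpa using h
  | mul s z ih => rw [mul_assoc, mul_assoc] at h; exact ih (of_mul_left_cancel h)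

variable (I) in
/-- The Garside element. -/
def garside : I.Mon := I.of ⟨I.top, I.K.le_refl _⟩

theorem of_mul_compl (s : I.Simple) : I.of s * I.of (I.compl s) = I.garside :=
  of_mul_inv (u := ⟨I.top, I.K.le_refl _⟩) s.2

/-- Conjugation by the top of the interval. -/
def conjTop (s : I.Simple) : I.Simple := I.compl (I.compl s)

theorem conjTop_val (s : I.Simple) : (conjTop s).1 = I.top⁻¹ * s.1 * I.top := by
  simp [conjTop, compl, mul_assoc]

theorem of_mul_garside (s : I.Simple) : I.of s * I.garside = I.garside * I.of (conjTop s) := by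
  have h : I.of (I.compl s) * I.of (conjTop s) = I.garside := of_mul_compl (I.compl s)
  rw [← of_mul_compl s, mul_assoc (I.of s) (I.of (I.compl s)), h, of_mul_compl]

theorem of_mul_garside_pow (s : I.Simple) (k : ℕ) :
    I.of s * I.garside ^ k = I.garside ^ k * I.of (conjTop^[k] s) := by
  induction k generalizing s with
  | zero => simp
  | succ k ih =>
    rw [pow_succ', ← mul_assoc, of_mul_garside, mul_assoc, ih, Function.iterate_succ_apply,
      ← mul_assoc]

theorem iterate_conjTop_val (s : I.Simple) (k : ℕ) :
    (conjTop^[k] s).1 = (I.top ^ k)⁻¹ * s.1 * I.top ^ k := by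
  induction k generalizing s with
  | zero => simp
  | succ k ih =>
    rw [Function.iterate_succ_apply, ih, conjTop_val, pow_succ']
    group

theorem commute_garside_pow {k : ℕ} (hk : I.top ^ k = 1) (x : I.Mon) :
    x * I.garside ^ k = I.garside ^ k * x := by
  induction x using Mon.induction with
  | one => simp
  | mul s x ih =>
    have : conjTop^[k] s = s := Subtype.ext (by rw [iterate_conjTop_val, hk]; simp)
    rw [mul_assoc, ih, ← mul_assoc, of_mul_garside_pow, this, mul_assoc]

/-- The interval monoid embeds into a group, if the top has finite order. -/
theorem exists_embedding {W : Type u} [Group W] {I : IntervalLattice W} {k : ℕ} (hk : I.top ^ k = 1) (hk0 : k ≠ 0) :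
    ∃ (R : Type u) (_ : Monoid R) (f : I.Mon →* Rˣ), Function.Injective f := by
  classical
  -- `Δ^k` is central because `top^k = 1`, so its powers form an Ore set; cancellation makes the
  -- localization injective.
  let Z : Submonoid I.Mon := Submonoid.powers (I.garside ^ k)
  have hZ : ∀ (z : Z) (x : I.Mon), x * z = z * x := by
    rintro ⟨_, j, rfl⟩ x
    show x * (I.garside ^ k) ^ j = (I.garside ^ k) ^ j * x
    rw [← pow_mul]
    exact commute_garside_pow (by rw [pow_mul, hk, one_pow]) x
  let _ : OreLocalization.OreSet Z :=
    { ore_right_cancel := fun r₁ r₂ s h => ⟨s, by rw [← hZ, ← hZ, h]⟩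
      oreNum := fun r _ => r
      oreDenom := fun _ s => s
      ore_eq := fun r s => (hZ s r).symm }
  let ι : I.Mon →* OreLocalization Z I.Mon := OreLocalization.numeratorHom
  have hι : Function.Injective ι := by
    intro x y h
    have h' : x /ₒ (1 : Z) = y /ₒ (1 : Z) := h
    rw [OreLocalization.oreDiv_eq_iff] at h'
    obtain ⟨u, v, h1, h2⟩ := h'
    simp only [OneMemClass.coe_one, mul_one] at h2
    rw [← h2] at h1
    exact (left_cancel (z := (u : I.Mon)) h1).symm
  have hΔk : IsUnit (ι (I.garside ^ k)) :=
    OreLocalization.numerator_isUnit (⟨_, 1, pow_one _⟩ : Z)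
  have hΔ : IsUnit (ι I.garside) := by
    rw [map_pow] at hΔk
    exact (isUnit_pow_iff hk0).1 hΔk
  -- Every generator divides the unit `Δ` on both sides, hence has a left and a right inverse.
  have hs : ∀ s, IsUnit (ι (I.of s)) := by
    intro s
    have h1 : ι (I.of s) * ι (I.of (I.compl s)) = ι I.garside := by rw [← map_mul, of_mul_compl]
    have h2 : ι (I.of (I.compl (conjTop^[k - 1] s))) * ι (I.of s) = ι I.garside := by
      rw [← map_mul]
      have : conjTop (conjTop^[k - 1] s) = s := by
        rw [← Function.iterate_succ_apply' conjTop, Nat.succ_eq_add_one,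
          Nat.sub_add_cancel (Nat.pos_of_ne_zero hk0)]
        exact Subtype.ext (by rw [iterate_conjTop_val, hk]; simp)
      have h3 := of_mul_compl (I.compl (conjTop^[k - 1] s))
      rw [show I.compl (I.compl (conjTop^[k - 1] s)) = s from this] at h3
      rw [h3]
    obtain ⟨d, hd⟩ := hΔ
    rw [← hd] at h1 h2
    have e1 : ι (I.of s) * (ι (I.of (I.compl s)) * ↑d⁻¹) = 1 := by
      rw [← mul_assoc, h1, Units.mul_inv]
    have e2 : (↑d⁻¹ * ι (I.of (I.compl (conjTop^[k - 1] s)))) * ι (I.of s) = 1 := by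
      rw [mul_assoc, h2, Units.inv_mul]
    have e3 := left_inv_eq_right_inv e2 e1
    exact ⟨⟨_, _, e1, e3 ▸ e2⟩, rfl⟩
  have hall : ∀ x, IsUnit (ι x) := by
    intro x
    induction x using Mon.induction with
    | one => rw [map_one]; exact isUnit_one
    | mul s x ih => rw [map_mul]; exact (hs s).mul ih
  refine ⟨OreLocalization Z I.Mon, inferInstance, IsUnit.liftRight ι hall, fun x y h => hι ?_⟩
  rw [← IsUnit.coe_liftRight ι hall x, h, IsUnit.coe_liftRight]

variable (I) in
/-- The elements which are products of at most `k` generators. -/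
def bounded (k : ℕ) : Set I.Mon := {x | ∃ l : List I.Simple, l.length ≤ k ∧ x = (l.map I.of).prod}

theorem tail_mem_bounded {k : ℕ} {x : I.Mon} (h : x ∈ I.bounded k) : tail x ∈ I.bounded (k - 1) := by
  obtain ⟨l, hl, rfl⟩ := h
  induction l generalizing k with
  | nil => exact ⟨[], by simp, by simp [tail_one]⟩
  | cons s l ih =>
    rw [List.map_cons, List.prod_cons, tail_of_mul]
    rcases l with _ | ⟨t, l⟩
    · refine ⟨[], by simp, ?_⟩
      have : tailMul s ⟨1, I.K.one_le _⟩ = ⟨1, I.K.one_le _⟩ :=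
        Subtype.ext (by simp [tailMul, cut_of_one])
      simp [head_one, tail_one, this, of_one]
    · obtain ⟨m, hm, hm'⟩ := ih (k := k - 1) (by simp at hl ⊢; omega)
      refine ⟨tailMul s (head ((t :: l).map I.of).prod) :: m, ?_, by rw [hm']; simp⟩
      simp at hl hm ⊢; omega

theorem of_mul_mem_bounded {k : ℕ} {x : I.Mon} (hk : k ≠ 0) (h : x ∈ I.bounded (k - 1))
    (s : I.Simple) : I.of s * x ∈ I.bounded k := by
  obtain ⟨l, hl, rfl⟩ := h
  exact ⟨s :: l, by simp; omega, by simp⟩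

/-- Products of at most `k` generators are closed under right divisors. -/
theorem mem_bounded_of_mul {k : ℕ} {x y : I.Mon} (hk : k ≠ 0) (h : x * y ∈ I.bounded k) :
    y ∈ I.bounded k := by
  induction x using Mon.induction with
  | one => simpa using h
  | mul s x ih =>
    apply ih
    -- The product `x y` is one generator times the tail of `s x y`, and that tail has a word
    -- shorter by one.
    rw [eq_cut_mul_tail s (x * y), ← mul_assoc]
    exact of_mul_mem_bounded hk (tail_mem_bounded h) _

/-- The head of `x y` is `Δ` and depends on `y` only through `head y`. This keeps the conjugator
positive under cycling. -/
theorem garside_dvd_head {x y z : I.Mon} (h : x * y = I.garside * z) :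
    ∃ w, x * I.of (head y) = I.garside * w := by
  refine ⟨tail (x * I.of (head y)), ?_⟩
  have h1 : head (x * I.of (head y)) = ⟨I.top, I.K.le_refl _⟩ := by
    rw [← head_mul, h, garside, head_of_mul]
    apply Subtype.ext
    show I.top * cut _ _ = I.top
    have := cut_le_compl ⟨I.top, I.K.le_refl _⟩ (head z)
    rw [inv_mul_cancel] at this
    rw [this.antisymm (I.K.one_le _), mul_one]
  rw [garside, ← h1, head_mul_tail]

end IntervalLattice

/-! ### The absolute order on permutations through moved spaces. -/

namespace PermLen

open Module ConjLength

variable {α : Type*}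

theorem perm_inv_apply (w : Equiv.Perm α) (x : α) : w⁻¹ (w x) = x := Equiv.symm_apply_apply w x

theorem perm_apply_inv (w : Equiv.Perm α) (x : α) : w (w⁻¹ x) = x := Equiv.apply_symm_apply w x

/-- A permutation of `α` acting on functions on `α`, minus the identity. -/
def subId (w : Equiv.Perm α) : (α → ℚ) →ₗ[ℚ] (α → ℚ) :=
  LinearMap.funLeft ℚ ℚ (w⁻¹ : Equiv.Perm α) - LinearMap.id

theorem subId_apply (w : Equiv.Perm α) (f : α → ℚ) (x : α) : subId w f x = f (w⁻¹ x) - f x := rfl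

/-- The moved space of a permutation. -/
def mov (w : Equiv.Perm α) : Submodule ℚ (α → ℚ) := LinearMap.range (subId w)

/-- The fixed space of a permutation. -/
def fixed (w : Equiv.Perm α) : Submodule ℚ (α → ℚ) := LinearMap.ker (subId w)

theorem mem_fixed {w : Equiv.Perm α} {f : α → ℚ} : f ∈ fixed w ↔ ∀ x, f (w x) = f x := by
  rw [fixed, LinearMap.mem_ker, funext_iff]
  constructor
  · intro h x
    have := h (w x)
    rw [subId_apply, perm_inv_apply] at this
    simp only [Pi.zero_apply] at this
    linarith
  · intro h x
    have := h (w⁻¹ x)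
    rw [perm_apply_inv] at this
    simp [subId_apply, this]

theorem mem_mov {w : Equiv.Perm α} {g : α → ℚ} : g ∈ mov w ↔ ∃ f : α → ℚ, ∀ x, f (w⁻¹ x) - f x = g x := by
  simp only [mov, LinearMap.mem_range, funext_iff, subId_apply]

theorem fixed_inf_le (x y : Equiv.Perm α) : fixed x ⊓ fixed y ≤ fixed (x * y) := by
  rintro f ⟨h1, h2⟩
  rw [SetLike.mem_coe, mem_fixed] at h1 h2
  rw [mem_fixed]
  intro a
  rw [Equiv.Perm.mul_apply, h1, h2]

theorem fixed_inv (x : Equiv.Perm α) : fixed x⁻¹ = fixed x := by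
  ext f
  rw [mem_fixed, mem_fixed]
  constructor
  · intro h a; rw [← h (x a), perm_inv_apply]
  · intro h a; rw [← h (x⁻¹ a), perm_apply_inv]

theorem mov_mul_le (x y : Equiv.Perm α) : mov (x * y) ≤ mov x ⊔ mov y := by
  intro g hg
  obtain ⟨f, hf⟩ := mem_mov.1 hg
  rw [Submodule.mem_sup]
  refine ⟨subId x (fun a => f (y⁻¹ a)), ⟨_, rfl⟩, subId y f, ⟨_, rfl⟩, ?_⟩
  funext a
  rw [Pi.add_apply, subId_apply, subId_apply, ← hf, mul_inv_rev, Equiv.Perm.mul_apply]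
  ring

section

variable [DecidableEq α]

/-- The root of a transposition. -/
def root (i j : α) : α → ℚ := Pi.single i 1 - Pi.single j 1

theorem root_apply (i j x : α) : root i j x = (if x = i then 1 else 0) - (if x = j then 1 else 0) := by
  simp [root, Pi.single_apply]

theorem root_swap (i j : α) : root j i = -root i j := by simp [root]

theorem mov_swap_le (i j : α) : mov (Equiv.swap i j) ≤ Submodule.span ℚ {root i j} := by
  rintro _ ⟨f, rfl⟩
  rw [Submodule.mem_span_singleton]
  refine ⟨f j - f i, ?_⟩
  funext x
  rw [Pi.smul_apply, root_apply, subId_apply, Equiv.swap_inv, Equiv.swap_apply_def]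
  split_ifs <;> simp_all

theorem root_mem_mov_swap {i j : α} : root i j ∈ mov (Equiv.swap i j) := by
  rw [mem_mov]
  refine ⟨Pi.single j 1, fun x => ?_⟩
  rw [root_apply, Equiv.swap_inv, Pi.single_apply, Pi.single_apply, Equiv.swap_apply_def]
  split_ifs <;> simp_all

end

theorem finrank_fixed_conj (x y : Equiv.Perm α) :
    finrank ℚ (fixed (x * y * x⁻¹)) = finrank ℚ (fixed y) := by
  have : fixed (x * y * x⁻¹) = (fixed y).comap
      (LinearEquiv.funCongrLeft ℚ ℚ x : (α → ℚ) ≃ₗ[ℚ] (α → ℚ)).toLinearMap := by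
    ext f
    rw [Submodule.mem_comap, mem_fixed, mem_fixed]
    constructor
    · intro h a
      have := h (x a)
      simpa using this
    · intro h a
      have := h (x⁻¹ a)
      simpa using this
  rw [this, Submodule.comap_equiv_eq_map_symm, LinearEquiv.finrank_map_eq]

theorem eq_one_of_fixed {w : Equiv.Perm α} (h : fixed w = ⊤) : w = 1 := by
  classical
  refine Equiv.ext fun x => ?_
  have : (Pi.single x 1 : α → ℚ) ∈ fixed w := h ▸ Submodule.mem_top
  have := mem_fixed.1 this x
  by_contra hne
  change ¬ w x = x at hne
  rw [Pi.single_eq_same, Pi.single_eq_of_ne hne] at this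
  exact zero_ne_one this

variable [Fintype α]

/-- Permutations act orthogonally, so the fixed space is the orthogonal complement of the moved
space. -/
theorem mem_fixed_iff_mov {w : Equiv.Perm α} {f : α → ℚ} :
    f ∈ fixed w ↔ ∀ g ∈ mov w, ∑ x, f x * g x = 0 := by
  classical
  constructor
  · intro hf g hg
    obtain ⟨h, hh⟩ := mem_mov.1 hg
    simp only [← hh, mul_sub, Finset.sum_sub_distrib]
    rw [sub_eq_zero, ← Equiv.sum_comp w]
    simp only [perm_inv_apply, mem_fixed.1 hf]
  · intro h
    rw [mem_fixed]
    intro x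
    have := h _ (mem_mov.2 ⟨Pi.single x 1, fun _ => rfl⟩)
    simp only [mul_sub, Finset.sum_sub_distrib] at this
    rw [← Equiv.sum_comp w] at this
    simp only [perm_inv_apply, Pi.single_apply, mul_ite, mul_one, mul_zero,
      Finset.sum_ite_eq', Finset.mem_univ, if_true] at this
    linarith

theorem fixed_anti {x y : Equiv.Perm α} (h : mov x ≤ mov y) : fixed y ≤ fixed x := fun _ hf =>
  mem_fixed_iff_mov.2 fun g hg => mem_fixed_iff_mov.1 hf g (h hg)

theorem finrank_mov_add_fixed (w : Equiv.Perm α) :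
    finrank ℚ (mov w) + finrank ℚ (fixed w) = Fintype.card α := by
  rw [mov, fixed, LinearMap.finrank_range_add_finrank_ker, Module.finrank_fintype_fun_eq_card]

variable (α) in
/-- The absolute length of permutations. -/
noncomputable def permLen : ConjLength (Equiv.Perm α) where
  -- This dimension is the number of points minus the number of cycles.
  len w := finrank ℚ (mov w)
  len_one := by
    have : mov (1 : Equiv.Perm α) = ⊥ := by
      rw [eq_bot_iff]
      rintro _ ⟨f, rfl⟩
      rw [Submodule.mem_bot]
      funext x
      simp [subId_apply]
    rw [this, finrank_bot]
  eq_one w h := by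
    apply eq_one_of_fixed
    apply Submodule.eq_top_of_finrank_eq
    have := finrank_mov_add_fixed w
    rw [Module.finrank_fintype_fun_eq_card]
    omega
  len_mul_le x y := (Submodule.finrank_mono (mov_mul_le x y)).trans
    (Submodule.finrank_add_le_finrank_add_finrank _ _)
  len_conj x y := by
    have h1 := finrank_mov_add_fixed (x * y * x⁻¹)
    have h2 := finrank_mov_add_fixed y
    rw [finrank_fixed_conj] at h1
    omega

theorem len_add_fixed (w : Equiv.Perm α) :
    (permLen α).len w + finrank ℚ (fixed w) = Fintype.card α := finrank_mov_add_fixed w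

variable {x y w c : Equiv.Perm α}

theorem mov_inf_eq_bot (h : (permLen α).le x c) : mov x ⊓ mov (x⁻¹ * c) = ⊥ := by
  have h1 := Submodule.finrank_sup_add_finrank_inf_eq (mov x) (mov (x⁻¹ * c))
  have h2 := Submodule.finrank_mono (mov_mul_le x (x⁻¹ * c))
  rw [mul_inv_cancel_left] at h2
  have h3 : finrank ℚ (mov x) + finrank ℚ (mov (x⁻¹ * c)) = finrank ℚ (mov c) := h
  exact Submodule.finrank_eq_zero.1 (by omega)

theorem mov_mono (h : (permLen α).le x c) : mov x ≤ mov c := by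
  have h1 := Submodule.finrank_sup_add_finrank_inf_eq (mov x) (mov (x⁻¹ * c))
  have h2 := mov_mul_le x (x⁻¹ * c)
  rw [mul_inv_cancel_left] at h2
  have h3 : finrank ℚ (mov x) + finrank ℚ (mov (x⁻¹ * c)) = finrank ℚ (mov c) := h
  rw [Submodule.eq_of_le_of_finrank_le h2 (by omega)]
  exact le_sup_left

/-- The functions fixed by the complement of `x` in `c`. -/
theorem mem_fixed_compl (h : (permLen α).le x c) {f : α → ℚ} :
    f ∈ fixed (x⁻¹ * c) ↔ subId c f ∈ mov x := by
  -- This is `c - 1 = (x - 1)(x⁻¹c) + (x⁻¹c - 1)`; the two moved spaces meet in zero.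
  have e : subId c f = subId x (fun a => f ((x⁻¹ * c)⁻¹ a)) + subId (x⁻¹ * c) f := by
    funext a
    rw [Pi.add_apply, subId_apply, subId_apply, subId_apply]
    simp
  constructor
  · intro hf
    rw [fixed, LinearMap.mem_ker] at hf
    rw [e, hf, add_zero]
    exact ⟨_, rfl⟩
  · intro hf
    rw [e] at hf
    have h1 : subId (x⁻¹ * c) f ∈ mov x :=
      (Submodule.add_mem_iff_right _ (LinearMap.mem_range_self _ _)).1 hf
    have h2 : subId (x⁻¹ * c) f ∈ mov x ⊓ mov (x⁻¹ * c) := ⟨h1, _, rfl⟩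
    rw [mov_inf_eq_bot h, Submodule.mem_bot] at h2
    exact h2

/-- Inside an interval, the order is the inclusion of moved spaces. -/
theorem le_of_mov_le (hx : (permLen α).le x c) (hy : (permLen α).le y c) (h : mov x ≤ mov y) :
    (permLen α).le x y := by
  apply le_of_len_le
  have e1 : fixed (x⁻¹ * c) ≤ fixed (y⁻¹ * c) := fun f hf =>
    (mem_fixed_compl hy).2 (h ((mem_fixed_compl hx).1 hf))
  -- As `x⁻¹y = (x⁻¹c)(y⁻¹c)⁻¹`, it fixes what `x⁻¹c` fixes, and also what `y` fixes. The dimension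
  -- of the sum bounds the length of `x⁻¹y`.
  have e2 : fixed (x⁻¹ * c) ⊔ fixed y ≤ fixed (x⁻¹ * y) := by
    apply sup_le
    · intro f hf
      have h1 := mem_fixed.1 hf
      have h2 := mem_fixed.1 (e1 hf)
      rw [← fixed_inv, mem_fixed]
      intro a
      have h3 := h2 (c⁻¹ (x a))
      have h4 := h1 (c⁻¹ (x a))
      simp only [Equiv.Perm.coe_mul, Function.comp_apply, mul_inv_rev, inv_inv, perm_apply_inv,
        perm_inv_apply] at h3 h4 ⊢
      rw [h3, ← h4]
    · refine fun f hf => fixed_inf_le _ _ ⟨?_, hf⟩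
      rw [fixed_inv]
      exact fixed_anti h hf
  have e3 : fixed (x⁻¹ * c) ⊓ fixed y ≤ fixed c := by
    refine fun f hf => ?_
    have := fixed_inf_le y (y⁻¹ * c) ⟨hf.2, e1 hf.1⟩
    rwa [mul_inv_cancel_left] at this
  have h1 := Submodule.finrank_sup_add_finrank_inf_eq (fixed (x⁻¹ * c)) (fixed y)
  have h2 := Submodule.finrank_mono e2
  have h3 := Submodule.finrank_mono e3
  have l1 := len_add_fixed (x⁻¹ * c)
  have l2 := len_add_fixed (x⁻¹ * y)
  have l3 := len_add_fixed y
  have l4 := len_add_fixed c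
  unfold le at hx
  omega

variable [DecidableEq α]

theorem len_swap {i j : α} (h : i ≠ j) : (permLen α).len (Equiv.swap i j) = 1 := by
  apply le_antisymm
  · refine (Submodule.finrank_mono (mov_swap_le i j)).trans ?_
    exact (finrank_span_le_card _).trans (by simp)
  · rw [Nat.one_le_iff_ne_zero]
    intro h0
    exact h (Equiv.swap_eq_one_iff.1 ((permLen α).eq_one _ h0))

/-- A transposition lies below a permutation when its root is moved. -/
theorem swap_le {i j : α} (hij : i ≠ j) (h : root i j ∈ mov w) :
    (permLen α).le (Equiv.swap i j) w := by
  apply le_of_len_le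
  rw [len_swap hij, Equiv.swap_inv]
  obtain ⟨v, hv⟩ := mem_mov.1 h
  -- Equality of the norms of `v` and `w v = v + root` forces `⟨v, root⟩ = -1`. So `w v` is the
  -- reflection of `v`, and `swap i j * w` fixes `v` while `w` does not.
  have hnorm : v i - v j = -1 := by
    have h1 : ∑ x, (v (w⁻¹ x)) ^ 2 = ∑ x, (v x) ^ 2 :=
      Equiv.sum_comp (w⁻¹) (fun x => v x ^ 2)
    have h2 : ∀ x, v (w⁻¹ x) ^ 2 = v x ^ 2 + (2 * v x * root i j x + root i j x ^ 2) := by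
      intro x
      have : v (w⁻¹ x) = v x + root i j x := by rw [← hv]; ring
      rw [this]; ring
    simp only [h2, Finset.sum_add_distrib] at h1
    have h3 : ∑ x, root i j x ^ 2 = 2 := by
      have : ∀ x, root i j x ^ 2 = (if x = i then 1 else 0) + (if x = j then 1 else 0) := by
        intro x; rw [root_apply]; split_ifs <;> simp_all
      simp only [this, Finset.sum_add_distrib, Finset.sum_ite_eq', Finset.mem_univ, if_true]
      norm_num
    have h4 : ∑ x, 2 * v x * root i j x = 2 * v i - 2 * v j := by
      simp only [root_apply, mul_sub, Finset.sum_sub_distrib, mul_ite, mul_one, mul_zero,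
        Finset.sum_ite_eq', Finset.mem_univ, if_true]
    linarith
  have hlt : fixed w < fixed (Equiv.swap i j * w) := by
    refine lt_of_le_of_ne ?_ ?_
    · refine fun f hf => fixed_inf_le _ _ ⟨?_, hf⟩
      refine fixed_anti ((mov_swap_le i j).trans ?_) hf
      rwa [Submodule.span_singleton_le_iff_mem]
    · intro heq
      have hmem : v ∈ fixed (Equiv.swap i j * w) := by
        rw [← fixed_inv, mem_fixed]
        intro x
        rw [mul_inv_rev, Equiv.swap_inv, Equiv.Perm.mul_apply]
        have : v (w⁻¹ (Equiv.swap i j x)) = v (Equiv.swap i j x) + root i j (Equiv.swap i j x) := by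
          rw [← hv]; ring
        rw [this, root_apply, Equiv.swap_apply_def]
        split_ifs <;> simp_all <;> linarith
      rw [← heq, ← fixed_inv, mem_fixed] at hmem
      have := hv i
      rw [hmem, root_apply] at this
      simp [hij] at this
  have h1 := Submodule.finrank_lt_finrank_of_lt hlt
  have l1 := len_add_fixed w
  have l2 := len_add_fixed (Equiv.swap i j * w)
  omega

theorem swap_le_iff {i j : α} (hij : i ≠ j) :
    (permLen α).le (Equiv.swap i j) w ↔ root i j ∈ mov w :=
  ⟨fun h => mov_mono h root_mem_mov_swap, swap_le hij⟩

theorem exists_swap_le (hw : w ≠ 1) : ∃ i, (permLen α).le (Equiv.swap i (w i)) w ∧ i ≠ w i := by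
  obtain ⟨i, hi⟩ : ∃ i, w i ≠ i := by
    by_contra h
    push Not at h
    exact hw (Equiv.ext h)
  refine ⟨i, swap_le (Ne.symm hi) ?_, Ne.symm hi⟩
  rw [mem_mov]
  refine ⟨-Pi.single i 1, fun x => ?_⟩
  rw [root_apply, Pi.neg_apply, Pi.neg_apply, Pi.single_apply, Pi.single_apply]
  have : w⁻¹ x = i ↔ x = w i := by rw [Equiv.Perm.inv_eq_iff_eq]
  simp only [this]
  ring

/-- Two transpositions below `w`, whose product lies in the interval. -/
theorem swap_mul_swap_le {i j k l : α} (hij : i ≠ j) (hkl : k ≠ l) (hw : (permLen α).le w c)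
    (h1 : (permLen α).le (Equiv.swap i j) w) (h2 : (permLen α).le (Equiv.swap k l) w)
    (h : root k l ∈ mov (Equiv.swap i j * c)) :
    (permLen α).len (Equiv.swap i j * Equiv.swap k l) = 2 ∧
      (permLen α).le (Equiv.swap i j * Equiv.swap k l) w := by
  have hc := h1.trans hw
  have h3 : (permLen α).le (Equiv.swap k l) ((Equiv.swap i j)⁻¹ * c) := swap_le hkl h
  refine ⟨by rw [hc.len_mul h3, len_swap hij, len_swap hkl], ?_⟩
  apply le_of_mov_le (hc.mul_le h3) hw
  exact (mov_mul_le _ _).trans (sup_le (mov_mono h1) (mov_mono h2))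

end PermLen

/-! ### The interval below the descending cycle. -/

namespace PermLen

open ConjLength

/-- The descending cycle `x ↦ x - 1`. -/
def cyc (n : ℕ) : Equiv.Perm (Fin n) := (finRotate n)⁻¹

theorem cyc_inv_val {n : ℕ} (x : Fin n) :
    ((cyc n)⁻¹ x : ℕ) = if (x : ℕ) + 1 = n then 0 else (x : ℕ) + 1 := by
  rw [cyc, inv_inv]
  match n with
  | 0 => exact x.elim0
  | m + 1 =>
    split_ifs with h
    · have : x = Fin.last m := Fin.ext (by simpa using h)
      rw [this, finRotate_last]; rfl
    · exact coe_finRotate_of_ne_last (fun h' => h (by rw [h']; rfl))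

/-- The indicator of a half-open interval. -/
def ioc {n : ℕ} (u v : Fin n) : Fin n → ℚ := fun x => if u < x ∧ x ≤ v then 1 else 0

variable {n : ℕ}

/-- Here `cyc - 1` is the cyclic difference `f (x + 1) - f x`. -/
theorem subId_cyc_ioc {u v : Fin n} (h : u < v) : subId (cyc n) (ioc u v) = root u v := by
  funext x
  rw [subId_apply, root_apply, ioc, ioc]
  simp only [Fin.lt_def, Fin.le_def, cyc_inv_val, Fin.ext_iff] at h ⊢
  have := v.isLt
  split_ifs <;> first | (exfalso; omega) | norm_num

theorem ioc_mul {i j k l : Fin n} (h1 : i ≤ k) (h2 : j ≤ l) : ioc i j * ioc k l = ioc k j := by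
  funext x
  simp only [ioc, Pi.mul_apply, Fin.lt_def, Fin.le_def] at *
  split_ifs <;> first | (exfalso; omega) | norm_num

theorem swap_le_cyc {u v : Fin n} (h : u ≠ v) : (permLen (Fin n)).le (Equiv.swap u v) (cyc n) := by
  rcases lt_or_gt_of_ne h with h | h
  · exact swap_le h.ne ⟨_, subId_cyc_ioc h⟩
  · rw [Equiv.swap_comm]
    exact swap_le h.ne ⟨_, subId_cyc_ioc h⟩

/-- The transposition preserves the indicator `f`, so applying it to `(c - 1) f = root u v` gives
`(swap * c - 1) f`. -/
theorem root_mem_mov_swap_mul {u v x y : Fin n} (h : u < v) (hxy : ioc u v x = ioc u v y) :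
    root (Equiv.swap x y u) (Equiv.swap x y v) ∈ mov (Equiv.swap x y * cyc n) := by
  rw [mem_mov]
  refine ⟨ioc u v, fun z => ?_⟩
  have h1 := congrFun (subId_cyc_ioc h) (Equiv.swap x y z)
  rw [subId_apply] at h1
  have h2 : ioc u v (Equiv.swap x y z) = ioc u v z := by
    rw [Equiv.swap_apply_def]; split_ifs <;> simp_all
  rw [mul_inv_rev, Equiv.swap_inv, Equiv.Perm.mul_apply, ← h2, h1, root_apply, root_apply]
  simp only [Equiv.swap_apply_eq_iff]

/-- Crossing transpositions below an element of the interval force a third one. -/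
theorem swap_le_of_crossing {w : Equiv.Perm (Fin n)} {i j k l : Fin n}
    (hw : (permLen (Fin n)).le w (cyc n)) (h1 : i < k) (h2 : k < j) (h3 : j < l)
    (hij : (permLen (Fin n)).le (Equiv.swap i j) w) (hkl : (permLen (Fin n)).le (Equiv.swap k l) w) :
    (permLen (Fin n)).le (Equiv.swap k j) w := by
  have hij' := (swap_le_iff (h1.trans h2).ne).1 hij
  have hkl' := (swap_le_iff (h2.trans h3).ne).1 hkl
  rw [← subId_cyc_ioc (h1.trans h2), ← mem_fixed_compl hw] at hij'
  rw [← subId_cyc_ioc (h2.trans h3), ← mem_fixed_compl hw] at hkl'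
  apply swap_le h2.ne
  -- The functions fixed by `w⁻¹c` are closed under pointwise product, and the indicators of `(i,
  -- j]` and `(k, l]` multiply to that of `(k, j]`.
  rw [← subId_cyc_ioc h2, ← mem_fixed_compl hw, ← ioc_mul h1.le h3.le, mem_fixed]
  intro x
  rw [Pi.mul_apply, Pi.mul_apply, mem_fixed.1 hij', mem_fixed.1 hkl']

theorem fixed_cyc (hn : 1 ≤ n) : Module.finrank ℚ (fixed (cyc n)) = 1 := by
  have : fixed (cyc n) = Submodule.span ℚ {fun _ => (1 : ℚ)} := by
    ext f
    rw [← fixed_inv, mem_fixed, Submodule.mem_span_singleton]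
    constructor
    · intro h
      refine ⟨f ⟨0, hn⟩, ?_⟩
      funext ⟨x, hx⟩
      rw [Pi.smul_apply, smul_eq_mul, mul_one]
      induction x with
      | zero => rfl
      | succ x ih =>
        rw [ih (by omega), ← h ⟨x, by omega⟩]
        congr 1
        apply Fin.ext
        rw [cyc_inv_val, if_neg]
        simp only; omega
    · rintro ⟨a, rfl⟩ x
      simp
  rw [this, finrank_span_singleton]
  intro h
  exact one_ne_zero (congrFun h ⟨0, hn⟩)

theorem len_cyc (hn : 1 ≤ n) : (permLen (Fin n)).len (cyc n) = n - 1 := by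
  have := len_add_fixed (cyc n)
  rw [fixed_cyc hn, Fintype.card_fin] at this
  omega

theorem cyc_pow (n : ℕ) : cyc n ^ n = 1 := by
  have h : ∀ k, ∀ x : Fin n, (((cyc n)⁻¹ ^ k) x : ℕ) = (x + k) % n := by
    intro k x
    induction k with
    | zero => simp [Nat.mod_eq_of_lt x.isLt]
    | succ k ih =>
      rw [pow_succ', Equiv.Perm.mul_apply, cyc_inv_val, ih, ← add_assoc]
      have hx := x.isLt
      rw [Nat.add_mod (x + k) 1 n]
      have hlt := Nat.mod_lt (x + k : ℕ) (show 0 < n by omega)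
      split_ifs with h
      · rcases Nat.lt_or_ge 1 n with h1 | h1
        · rw [Nat.mod_eq_of_lt h1, h, Nat.mod_self]
        · have : n = 1 := by omega
          subst this; simp [Nat.mod_one]
      · rw [Nat.mod_eq_of_lt (show 1 < n by omega), Nat.mod_eq_of_lt (show (x + k : ℕ) % n + 1 < n by omega)]
  rw [← inv_inj, ← inv_pow, inv_one]
  refine Equiv.ext fun x => Fin.ext ?_
  rw [h, Nat.add_mod_right, Nat.mod_eq_of_lt x.isLt]
  rfl

end PermLen

/-! ### Birman–Ko–Lee relations and the atoms of the interval. -/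

namespace BraidGrp

open PermLen ConjLength

variable {n : ℕ}

/-- The smaller strand of a band, as an element of `Fin n`. -/
def BandIdx.lo (p : BandIdx n) : Fin n := ⟨p.1.1 - 1, by have := p.2; omega⟩

/-- The larger strand of a band, as an element of `Fin n`. -/
def BandIdx.hi (p : BandIdx n) : Fin n := ⟨p.1.2 - 1, by have := p.2; omega⟩

/-- The transposition of a band. -/
def bandPerm (p : BandIdx n) : Equiv.Perm (Fin n) := Equiv.swap (BandIdx.lo p) (BandIdx.hi p)

theorem lo_lt_hi (p : BandIdx n) : BandIdx.lo p < BandIdx.hi p := by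
  have := p.2
  simp only [BandIdx.lo, BandIdx.hi, Fin.lt_def]; omega

/-- The Birman–Ko–Lee relations for a family of elements of a monoid indexed by bands. -/
structure BandRel {N : Type*} [Monoid N] (b : BandIdx n → N) : Prop where
  triangle_left : ∀ r s t (hrs : 1 ≤ r ∧ r < s ∧ s ≤ n) (hst : 1 ≤ s ∧ s < t ∧ t ≤ n)
    (hrt : 1 ≤ r ∧ r < t ∧ t ≤ n),
    b ⟨(s, t), hst⟩ * b ⟨(r, s), hrs⟩ = b ⟨(r, t), hrt⟩ * b ⟨(s, t), hst⟩
  triangle_right : ∀ r s t (hrs : 1 ≤ r ∧ r < s ∧ s ≤ n) (hst : 1 ≤ s ∧ s < t ∧ t ≤ n)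
    (hrt : 1 ≤ r ∧ r < t ∧ t ≤ n),
    b ⟨(s, t), hst⟩ * b ⟨(r, s), hrs⟩ = b ⟨(r, s), hrs⟩ * b ⟨(r, t), hrt⟩
  comm_far : ∀ p q : BandIdx n, p.1.2 < q.1.1 → b p * b q = b q * b p
  comm_nested : ∀ p q : BandIdx n, p.1.1 < q.1.1 → q.1.2 < p.1.2 → b p * b q = b q * b p

variable {N : Type*} [Monoid N] {b : BandIdx n → N}

/-- The root condition puts the product of the two transpositions in the interval with length two.
It is then below every `w` above both, the order being inclusion of moved spaces. -/
theorem joined_of_mem {p q r : BandIdx n} (ha : bandPerm p * bandPerm q = bandPerm q * bandPerm r)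
    (hb : b p * b q = b q * b r)
    (h : root (BandIdx.lo q) (BandIdx.hi q) ∈ mov (bandPerm p * cyc n)) :
    Joined (permLen (Fin n)) (cyc n) bandPerm b p q := by
  have hp := (lo_lt_hi p).ne
  have hq := (lo_lt_hi q).ne
  have key := fun w hw h1 h2 => swap_mul_swap_le (w := w) (c := cyc n) hp hq hw h1 h2 h
  refine ⟨q, r, ha, hb, ?_, fun w hw h1 h2 => (key w hw h1 h2).2⟩
  exact (key _ ((permLen _).le_refl _) (swap_le_cyc hp) (swap_le_cyc hq)).1

/-- The three transpositions on three points multiply cyclically. -/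
theorem swap_triangle {α : Type*} [DecidableEq α] {r s t : α} (h1 : r ≠ s) (h2 : s ≠ t)
    (h3 : r ≠ t) : Equiv.swap s t * Equiv.swap r s = Equiv.swap r t * Equiv.swap s t ∧
      Equiv.swap s t * Equiv.swap r s = Equiv.swap r s * Equiv.swap r t := by
  constructor
  · rw [Equiv.mul_swap_eq_swap_mul, Equiv.swap_apply_left, Equiv.swap_apply_of_ne_of_ne h1 h3]
  · rw [Equiv.swap_mul_eq_mul_swap, Equiv.swap_inv, Equiv.swap_apply_right,
      Equiv.swap_apply_of_ne_of_ne h3.symm h2.symm]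

theorem swap_commute {α : Type*} [DecidableEq α] {i j k l : α} (h1 : i ≠ k) (h2 : i ≠ l)
    (h3 : j ≠ k) (h4 : j ≠ l) :
    Equiv.swap i j * Equiv.swap k l = Equiv.swap k l * Equiv.swap i j := by
  rw [Equiv.mul_swap_eq_swap_mul, Equiv.swap_apply_of_ne_of_ne h1.symm h3.symm,
    Equiv.swap_apply_of_ne_of_ne h2.symm h4.symm]

theorem root_mem_triangle {r s t : Fin n} (h1 : r < s) (h2 : s < t) :
    root r s ∈ mov (Equiv.swap s t * cyc n) ∧ root s t ∈ mov (Equiv.swap r t * cyc n) ∧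
      root r t ∈ mov (Equiv.swap r s * cyc n) := by
  have h3 := h1.trans h2
  refine ⟨?_, ?_, ?_⟩
  · have := root_mem_mov_swap_mul (x := s) (y := t) h3 (by simp [ioc, h1, h2.le, h3])
    rwa [Equiv.swap_apply_of_ne_of_ne h1.ne h3.ne, Equiv.swap_apply_right] at this
  · have := root_mem_mov_swap_mul (x := r) (y := t) h1 (by simp [ioc, h2.not_ge])
    rw [Equiv.swap_apply_left, Equiv.swap_apply_of_ne_of_ne h1.ne' h2.ne, root_swap] at this
    have h := neg_mem this
    rwa [neg_neg] at h
  · have := root_mem_mov_swap_mul (x := r) (y := s) h2 (by simp [ioc, h1.not_gt])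
    rwa [Equiv.swap_apply_right, Equiv.swap_apply_of_ne_of_ne h3.ne' h2.ne'] at this

theorem joined_triangle (hb : BandRel b) {r s t : ℕ} (hrs : 1 ≤ r ∧ r < s ∧ s ≤ n)
    (hst : 1 ≤ s ∧ s < t ∧ t ≤ n) (hrt : 1 ≤ r ∧ r < t ∧ t ≤ n) :
    Joined (permLen (Fin n)) (cyc n) bandPerm b ⟨(s, t), hst⟩ ⟨(r, s), hrs⟩ ∧
    Joined (permLen (Fin n)) (cyc n) bandPerm b ⟨(r, t), hrt⟩ ⟨(s, t), hst⟩ ∧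
    Joined (permLen (Fin n)) (cyc n) bandPerm b ⟨(r, s), hrs⟩ ⟨(r, t), hrt⟩ := by
  have h1 := lo_lt_hi ⟨(r, s), hrs⟩
  have h2 := lo_lt_hi ⟨(s, t), hst⟩
  have h3 := lo_lt_hi ⟨(r, t), hrt⟩
  obtain ⟨e1, e2⟩ := swap_triangle h1.ne h2.ne h3.ne
  obtain ⟨m1, m2, m3⟩ := root_mem_triangle h1 h2
  have f1 := hb.triangle_left r s t hrs hst hrt
  have f2 := hb.triangle_right r s t hrs hst hrt
  exact ⟨joined_of_mem (r := ⟨(r, t), hrt⟩) e2 f2 m1,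
    joined_of_mem (r := ⟨(r, s), hrs⟩) e1.symm f1.symm m2,
    joined_of_mem (r := ⟨(s, t), hst⟩) (e2.symm.trans e1) (f2.symm.trans f1) m3⟩

theorem root_mem_comm {p q : BandIdx n}
    (h : p.1.2 < q.1.1 ∨ (p.1.1 < q.1.1 ∧ q.1.2 < p.1.2)) :
    bandPerm p * bandPerm q = bandPerm q * bandPerm p ∧
      root (BandIdx.lo q) (BandIdx.hi q) ∈ mov (bandPerm p * cyc n) ∧
      root (BandIdx.lo p) (BandIdx.hi p) ∈ mov (bandPerm q * cyc n) := by
  have hp := p.2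
  have hq := q.2
  have e : ∀ {x y : ℕ} (hx : x < n) (hy : y < n), x ≠ y → (⟨x, hx⟩ : Fin n) ≠ ⟨y, hy⟩ :=
    fun _ _ hne h => hne (Fin.mk.inj h)
  have h1 : BandIdx.lo p ≠ BandIdx.lo q := e _ _ (by omega)
  have h2 : BandIdx.lo p ≠ BandIdx.hi q := e _ _ (by omega)
  have h3 : BandIdx.hi p ≠ BandIdx.lo q := e _ _ (by omega)
  have h4 : BandIdx.hi p ≠ BandIdx.hi q := e _ _ (by omega)
  refine ⟨swap_commute h1 h2 h3 h4, ?_, ?_⟩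
  · have := root_mem_mov_swap_mul (x := BandIdx.lo p) (y := BandIdx.hi p) (lo_lt_hi q) (by
      simp only [ioc, BandIdx.lo, BandIdx.hi, Fin.lt_def, Fin.le_def]
      split_ifs <;> first | rfl | (exfalso; omega))
    rwa [Equiv.swap_apply_of_ne_of_ne h1.symm h3.symm,
      Equiv.swap_apply_of_ne_of_ne h2.symm h4.symm] at this
  · have := root_mem_mov_swap_mul (x := BandIdx.lo q) (y := BandIdx.hi q) (lo_lt_hi p) (by
      simp only [ioc, BandIdx.lo, BandIdx.hi, Fin.lt_def, Fin.le_def]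
      split_ifs <;> first | rfl | (exfalso; omega))
    rwa [Equiv.swap_apply_of_ne_of_ne h1 h2, Equiv.swap_apply_of_ne_of_ne h3 h4] at this

theorem joined_comm {p q : BandIdx n} (hb : b p * b q = b q * b p)
    (h : p.1.2 < q.1.1 ∨ (p.1.1 < q.1.1 ∧ q.1.2 < p.1.2)) :
    Joined (permLen (Fin n)) (cyc n) bandPerm b p q :=
  joined_of_mem (root_mem_comm h).1 hb (root_mem_comm h).2.1

theorem joined_cases (hb : BandRel b) (p q : BandIdx n) (hle : p.1.1 ≤ q.1.1) :
    p = q ∨ Joined (permLen (Fin n)) (cyc n) bandPerm b p q ∨ ∃ d,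
      (∀ w, (permLen (Fin n)).le w (cyc n) → (permLen (Fin n)).le (bandPerm p) w →
        (permLen (Fin n)).le (bandPerm q) w → (permLen (Fin n)).le (bandPerm d) w) ∧
      Joined (permLen (Fin n)) (cyc n) bandPerm b p d ∧
      Joined (permLen (Fin n)) (cyc n) bandPerm b d q := by
  obtain ⟨⟨i, j⟩, hij⟩ := p
  obtain ⟨⟨k, l⟩, hkl⟩ := q
  simp only at hle hij hkl
  rcases hle.eq_or_lt with rfl | hik
  · rcases lt_trichotomy j l with h | rfl | h
    · exact Or.inr (Or.inl (joined_triangle hb hij (t := l) (by omega) hkl).2.2)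
    · exact Or.inl rfl
    · exact Or.inr (Or.inl (joined_triangle hb hkl (t := j) (by omega) hij).2.2.symm)
  · rcases lt_trichotomy j k with h | rfl | h
    · exact Or.inr (Or.inl (joined_comm (hb.comm_far _ _ h) (Or.inl h)))
    · exact Or.inr (Or.inl (joined_triangle hb hij hkl (by omega)).1.symm)
    · rcases lt_trichotomy j l with h' | rfl | h'
      -- Crossing case: the band on the two inner endpoints forms a triangle with each of the given
      -- ones.
      · refine Or.inr (Or.inr ⟨⟨(k, j), by omega⟩, ?_, ?_, ?_⟩)
        · intro w hw h1 h2
          refine swap_le_of_crossing (i := ⟨i - 1, by omega⟩) (l := ⟨l - 1, by omega⟩) hw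
            ?_ ?_ ?_ h1 h2
          all_goals
            simp only [Fin.lt_def, BandIdx.lo, BandIdx.hi]
            omega
        · exact (joined_triangle hb (r := i) (s := k) (t := j) (by omega) (by omega) hij).2.1
        · exact (joined_triangle hb (r := k) (s := j) (t := l) (by omega) (by omega) hkl).2.2
      · exact Or.inr (Or.inl (joined_triangle hb (s := k) (by omega) hkl hij).2.1)
      · exact Or.inr (Or.inl (joined_comm (hb.comm_nested _ _ hik h') (Or.inr ⟨hik, h'⟩)))

/-- The transpositions are the atoms of the interval of noncrossing partitions. -/
theorem atomSystem (hb : BandRel b) : AtomSystem (permLen (Fin n)) (cyc n) bandPerm b where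
  len_atom p := len_swap (lo_lt_hi p).ne
  exists_atom w _ hw := by
    obtain ⟨i, hi, hne⟩ := exists_swap_le hw
    have : ∀ u v : Fin n, u < v → ∃ p : BandIdx n, bandPerm p = Equiv.swap u v := fun u v h =>
      ⟨⟨(u + 1, v + 1), by have := v.isLt; rw [Fin.lt_def] at h; omega⟩, rfl⟩
    rcases lt_or_gt_of_ne hne with h | h
    · obtain ⟨p, hp⟩ := this _ _ h
      exact ⟨p, hp ▸ hi⟩
    · obtain ⟨p, hp⟩ := this _ _ h
      rw [Equiv.swap_comm] at hi
      exact ⟨p, hp ▸ hi⟩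
  joined p q := by
    rcases le_total p.1.1 q.1.1 with h | h
    · exact joined_cases hb p q h
    · rcases joined_cases hb q p h with rfl | h | ⟨d, h1, h2, h3⟩
      · exact Or.inl rfl
      · exact Or.inr (Or.inl h.symm)
      · exact Or.inr (Or.inr ⟨d, fun w hw hp hq => h1 w hw hq hp, h3.symm, h2.symm⟩)

end BraidGrp

/-! ### The bands in Artin's presentation. -/

namespace BraidGrp

variable {n : ℕ}

theorem sigma_of {i : ℕ} (h : 1 ≤ i ∧ i < n) :
    sigma n i = PresentedGroup.of (rels := rels n) (⟨i, h⟩ : Idx n) := by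
  rw [sigma, dif_pos h]

theorem sigma_comm {i j : ℕ} (h : i + 2 ≤ j) : Commute (sigma n i) (sigma n j) := by
  by_cases hi : 1 ≤ i ∧ i < n
  · by_cases hj : 1 ≤ j ∧ j < n
    · rw [sigma_of hi, sigma_of hj]
      have := PresentedGroup.mk_eq_one_iff.2 (Subgroup.subset_normalClosure
        (show _ ∈ rels n from Or.inl ⟨⟨i, hi⟩, ⟨j, hj⟩, h, rfl⟩))
      rw [map_mul, map_inv, mul_inv_eq_one, map_mul, map_mul] at this
      exact this
    · rw [sigma, sigma, dif_neg hj]; exact Commute.one_right _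
  · rw [sigma, dif_neg hi]; exact Commute.one_left _

theorem sigma_braid {i : ℕ} (h1 : 1 ≤ i) (h2 : i + 1 < n) :
    sigma n i * sigma n (i + 1) * sigma n i = sigma n (i + 1) * sigma n i * sigma n (i + 1) := by
  have hi : 1 ≤ i ∧ i < n := by omega
  have hj : 1 ≤ i + 1 ∧ i + 1 < n := by omega
  rw [sigma_of hi, sigma_of hj]
  have := PresentedGroup.mk_eq_one_iff.2 (Subgroup.subset_normalClosure
    (show _ ∈ rels n from Or.inr ⟨⟨i, hi⟩, ⟨i + 1, hj⟩, rfl, rfl⟩))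
  rw [map_mul, map_inv, mul_inv_eq_one, map_mul, map_mul, map_mul, map_mul] at this
  exact this

/-- The band `a_{i, i + m + 1}`. -/
def arc (n i m : ℕ) : Braid n := descProd n (i + 1) m * sigma n i * (descProd n (i + 1) m)⁻¹

theorem band_eq_arc {i j : ℕ} (h : 1 ≤ i ∧ i < j ∧ j ≤ n) :
    band (⟨(i, j), h⟩ : BandIdx n) = arc n i (j - i - 1) := rfl

theorem arc_zero (i : ℕ) : arc n i 0 = sigma n i := by simp [arc, descProd]

theorem arc_succ (i m : ℕ) :
    arc n i (m + 1) = sigma n (i + 1 + m) * arc n i m * (sigma n (i + 1 + m))⁻¹ := by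
  simp only [arc, descProd]
  group

theorem commute_arc {z : Braid n} {i m : ℕ} (h : ∀ q, i ≤ q → q ≤ i + m → Commute z (sigma n q)) :
    Commute z (arc n i m) := by
  induction m with
  | zero => rw [arc_zero]; exact h i le_rfl le_rfl
  | succ m ih =>
    have h1 := h (i + 1 + m) (by omega) (by omega)
    rw [arc_succ]
    exact (h1.mul_right (ih fun q hq hq' => h q hq (by omega))).mul_right h1.inv_right

theorem arc_commute_above {i m k : ℕ} (h : i + m + 2 ≤ k) : Commute (sigma n k) (arc n i m) :=
  commute_arc fun _ _ _ => (sigma_comm (by omega)).symm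

/-- Further extension at the top uses generators commuting with `σ_k`. For the arc ending at strand
`k + 2`, conjugation by `σ_{k+1}σ_k` carries `σ_{k+1}`, which commutes with the shorter arc, to
`σ_k`. -/
theorem arc_commute_inside {i k : ℕ} (m : ℕ) (hi : i < k) (hn : k + 1 < n) (hk : k + 1 ≤ i + m) :
    Commute (sigma n k) (arc n i m) := by
  obtain ⟨d, rfl⟩ : ∃ d, m = (k - i - 1) + 2 + d := ⟨m - (k - i - 1) - 2, by omega⟩
  clear hk
  induction d with
  | zero =>
    rw [add_zero, arc_succ, arc_succ]
    have e1 : i + 1 + (k - i - 1 + 1) = k + 1 := by omega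
    have e2 : i + 1 + (k - i - 1) = k := by omega
    rw [e1, e2]
    have h1 := sigma_braid (n := n) (i := k) (by omega) hn
    have h2 : Commute (sigma n (k + 1)) (arc n i (k - i - 1)) := arc_commute_above (by omega)
    generalize arc n i (k - i - 1) = X at h2
    generalize sigma n k = s at h1 h2 ⊢
    generalize sigma n (k + 1) = t at h1 h2 ⊢
    have e3 : t * (s * X * s⁻¹) * t⁻¹ = (t * s) * X * (t * s)⁻¹ := by group
    have e4 : t * (t * s)⁻¹ = (t * s)⁻¹ * s := by
      rw [eq_inv_mul_iff_mul_eq, ← mul_assoc, mul_inv_eq_iff_eq_mul, ← h1, mul_assoc]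
    unfold Commute SemiconjBy at h2 ⊢
    rw [e3]
    calc s * (t * s * X * (t * s)⁻¹) = (s * t * s) * X * (t * s)⁻¹ := by group
      _ = t * s * (t * X) * (t * s)⁻¹ := by rw [h1]; group
      _ = t * s * X * (t * (t * s)⁻¹) := by rw [h2]; group
      _ = t * s * X * (t * s)⁻¹ * s := by rw [e4]; group
  | succ d ih =>
    rw [← add_assoc, arc_succ]
    have h1 : Commute (sigma n k) (sigma n (i + 1 + (k - i - 1 + 2 + d))) :=
      sigma_comm (by omega)
    exact (h1.mul_right ih).mul_right h1.inv_right

theorem arc_braid {i : ℕ} (m : ℕ) (hi : 1 ≤ i) (hm : i + 1 + m < n) :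
    arc n i m * sigma n (i + 1 + m) * arc n i m =
      sigma n (i + 1 + m) * arc n i m * sigma n (i + 1 + m) := by
  induction m with
  | zero => rw [arc_zero]; exact sigma_braid hi (by omega)
  | succ m ih =>
    have h1 := ih (by omega)
    have h2 := sigma_braid (n := n) (i := i + 1 + m) (by omega) (by omega)
    have h3 : Commute (sigma n (i + 1 + m + 1)) (arc n i m) := arc_commute_above (by omega)
    rw [arc_succ, show i + 1 + (m + 1) = i + 1 + m + 1 by omega]
    generalize arc n i m = A at h1 h3 ⊢
    generalize sigma n (i + 1 + m) = s at h1 h2 ⊢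
    generalize sigma n (i + 1 + m + 1) = t at h2 h3 ⊢
    have e1 : s * A * s⁻¹ = A⁻¹ * s * A := by
      rw [mul_inv_eq_iff_eq_mul, ← mul_right_inj A]
      calc A * (s * A) = A * s * A := by group
        _ = A * (A⁻¹ * s * A * s) := by rw [h1]; group
    unfold Commute SemiconjBy at h3
    have e2 : A * t * A⁻¹ = t := by rw [← h3]; group
    have e3 : t * A⁻¹ = A⁻¹ * t := by
      rw [eq_inv_mul_iff_mul_eq, ← mul_assoc, e2]
    rw [e1]
    calc A⁻¹ * s * A * t * (A⁻¹ * s * A) = A⁻¹ * s * (A * t * A⁻¹) * s * A := by group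
      _ = A⁻¹ * (s * t * s) * A := by rw [e2]; group
      _ = (A⁻¹ * t) * s * (t * A) := by rw [h2]; group
      _ = t * (A⁻¹ * s * A) * t := by rw [← e3, h3]; group

theorem arc_triangle {r k : ℕ} (m : ℕ) (hr : 1 ≤ r) (hm : r + k + 1 + m < n) :
    arc n (r + k + 1) m * arc n r k = arc n r (k + m + 1) * arc n (r + k + 1) m ∧
      arc n (r + k + 1) m * arc n r k = arc n r k * arc n r (k + m + 1) := by
  induction m with
  | zero =>
    rw [arc_zero, add_zero, arc_succ]
    have h := arc_braid (n := n) k hr (by omega)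
    rw [show r + k + 1 = r + 1 + k by omega]
    refine ⟨by group, ?_⟩
    rw [← mul_assoc, ← mul_assoc, h]
    group
  | succ m ih =>
    obtain ⟨h1, h2⟩ := ih (by omega)
    have h3 : Commute (sigma n (r + k + 1 + 1 + m)) (arc n r k) := arc_commute_above (by omega)
    rw [← add_assoc k m 1, arc_succ, arc_succ r (k + m + 1),
      show r + 1 + (k + m + 1) = r + k + 1 + 1 + m by omega]
    generalize sigma n (r + k + 1 + 1 + m) = g at h3 ⊢
    have e : arc n r k = g * arc n r k * g⁻¹ := by rw [h3.eq]; group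
    rw [e]
    constructor
    · calc _ = g * (arc n (r + k + 1) m * arc n r k) * g⁻¹ := by group
        _ = _ := by rw [h1]; group
    · calc _ = g * (arc n (r + k + 1) m * arc n r k) * g⁻¹ := by group
        _ = _ := by rw [h2]; group

theorem bandRel_band : BandRel (band (n := n)) where
  triangle_left r s t hrs hst hrt := by
    have := (arc_triangle (n := n) (r := r) (k := s - r - 1) (t - s - 1) hrs.1 (by omega)).1
    rwa [show r + (s - r - 1) + 1 = s by omega,
      show s - r - 1 + (t - s - 1) + 1 = t - r - 1 by omega] at this
  triangle_right r s t hrs hst hrt := by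
    have := (arc_triangle (n := n) (r := r) (k := s - r - 1) (t - s - 1) hrs.1 (by omega)).2
    rwa [show r + (s - r - 1) + 1 = s by omega,
      show s - r - 1 + (t - s - 1) + 1 = t - r - 1 by omega] at this
  comm_far := by
    rintro ⟨⟨i, j⟩, hij⟩ ⟨⟨k, l⟩, hkl⟩ h
    simp only at h hij hkl
    exact commute_arc (i := k) (m := l - k - 1) fun q hq hq' =>
      (arc_commute_above (i := i) (m := j - i - 1) (by omega)).symm
  comm_nested := by
    rintro ⟨⟨i, j⟩, hij⟩ ⟨⟨k, l⟩, hkl⟩ h h'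
    simp only at h h' hij hkl
    exact commute_arc (i := k) (m := l - k - 1) fun q hq hq' =>
      (arc_commute_inside (i := i) (j - i - 1) (by omega) (by omega) (by omega)).symm

/-- A family in a group satisfying the Birman–Ko–Lee relations comes from a homomorphism. -/
theorem BandRel.exists_hom {G : Type*} [Group G] {b : BandIdx n → G} (hb : BandRel b) :
    ∃ φ : Braid n →* G, ∀ p, φ (band p) = b p := by
  -- Only the bands `(i, i + 1)` are prescribed; the triangle relations force the rest.
  have hrel : ∀ w ∈ rels n,
      FreeGroup.lift (fun i : Idx n => b ⟨(i.1, i.1 + 1), by have := i.2; omega⟩) w = 1 := by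
    rintro w (⟨i, j, hij, rfl⟩ | ⟨⟨i, hi⟩, ⟨j, hj⟩, hij, rfl⟩)
    · rw [map_mul, map_inv, mul_inv_eq_one, map_mul, map_mul, FreeGroup.lift_apply_of,
        FreeGroup.lift_apply_of]
      exact hb.comm_far _ _ hij
    · simp only at hij
      subst hij
      rw [map_mul, map_inv, mul_inv_eq_one]
      simp only [map_mul, FreeGroup.lift_apply_of]
      have h1 := hb.triangle_left i (i + 1) (i + 1 + 1) (by omega) (by omega) (by omega)
      have h2 := hb.triangle_right i (i + 1) (i + 1 + 1) (by omega) (by omega) (by omega)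
      rw [mul_assoc, h1, ← mul_assoc, ← h2, h1]
  refine ⟨PresentedGroup.toGroup hrel, ?_⟩
  have hs : ∀ i (h : 1 ≤ i ∧ i < n), PresentedGroup.toGroup hrel (sigma n i) =
      b ⟨(i, i + 1), by omega⟩ := by
    intro i h
    rw [sigma_of h, PresentedGroup.toGroup.of]
  have ha : ∀ m i (h : 1 ≤ i ∧ i + m + 1 ≤ n), PresentedGroup.toGroup hrel (arc n i m) =
      b ⟨(i, i + m + 1), by omega⟩ := by
    intro m i
    induction m with
    | zero => intro h; rw [arc_zero]; exact hs i (by omega)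
    | succ m ih =>
      intro h
      rw [arc_succ, map_mul, map_mul, map_inv, ih (by omega), hs _ (by omega),
        mul_inv_eq_iff_eq_mul]
      have := hb.triangle_left i (i + m + 1) (i + m + 1 + 1) (by omega) (by omega) (by omega)
      simp only [show i + 1 + m = i + m + 1 by omega]
      exact this
  rintro ⟨⟨i, j⟩, hij⟩
  simp only at hij
  rw [band_eq_arc, ha _ _ (by omega)]
  simp only [show i + (j - i - 1) + 1 = j by omega]

end BraidGrp

/-! ### The dual braid monoid inside the braid group. -/

namespace BraidGrp

open PermLen ConjLength IntervalLattice

variable {n : ℕ}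

/-- The lattice of noncrossing partitions, as an interval of permutations. -/
noncomputable def noncrossing (n : ℕ) : IntervalLattice (Equiv.Perm (Fin n)) where
  K := permLen (Fin n)
  top := cyc n
  -- Meets do not involve `b`, so a constant family suffices.
  exists_meet _ _ hx hy := (atomSystem (b := fun _ : BandIdx n => (1 : ℕ))
    ⟨fun _ _ _ _ _ _ => rfl, fun _ _ _ _ _ _ => rfl, fun _ _ _ => rfl,
      fun _ _ _ _ => rfl⟩).exists_meet hx hy

/-- The dual braid monoid. -/
abbrev DualMon (n : ℕ) := (noncrossing n).Mon

/-- The atom of the dual braid monoid given by a band. -/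
noncomputable def atom (p : BandIdx n) : DualMon n :=
  (noncrossing n).of ⟨bandPerm p, swap_le_cyc (lo_lt_hi p).ne⟩

theorem atom_mul_atom {p q : BandIdx n}
    (h : root (BandIdx.lo q) (BandIdx.hi q) ∈ mov (bandPerm p * cyc n)) :
    ∃ hle, atom p * atom q = (noncrossing n).of ⟨bandPerm p * bandPerm q, hle⟩ := by
  have h1 : (permLen (Fin n)).le (bandPerm p) (cyc n) := swap_le_cyc (lo_lt_hi p).ne
  have h2 : (permLen (Fin n)).le (bandPerm q) ((bandPerm p)⁻¹ * cyc n) :=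
    swap_le (lo_lt_hi q).ne h
  exact ⟨h1.mul_le h2, of_mul rfl (h1.le_mul h2)⟩

theorem atom_mul_atom_eq {p q r s : BandIdx n}
    (h : root (BandIdx.lo q) (BandIdx.hi q) ∈ mov (bandPerm p * cyc n))
    (h' : root (BandIdx.lo s) (BandIdx.hi s) ∈ mov (bandPerm r * cyc n))
    (he : bandPerm p * bandPerm q = bandPerm r * bandPerm s) :
    atom p * atom q = atom r * atom s := by
  obtain ⟨h1, e1⟩ := atom_mul_atom h
  obtain ⟨h2, e2⟩ := atom_mul_atom h'
  rw [e1, e2]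
  simp only [he]

theorem bandRel_atom : BandRel (atom (n := n)) where
  triangle_left r s t hrs hst hrt := by
    have h1 := lo_lt_hi ⟨(r, s), hrs⟩
    have h2 := lo_lt_hi ⟨(s, t), hst⟩
    obtain ⟨m1, m2, m3⟩ := root_mem_triangle h1 h2
    exact atom_mul_atom_eq (p := ⟨(s, t), hst⟩) (q := ⟨(r, s), hrs⟩) (r := ⟨(r, t), hrt⟩)
      (s := ⟨(s, t), hst⟩) m1 m2 (swap_triangle h1.ne h2.ne (h1.trans h2).ne).1
  triangle_right r s t hrs hst hrt := by
    have h1 := lo_lt_hi ⟨(r, s), hrs⟩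
    have h2 := lo_lt_hi ⟨(s, t), hst⟩
    obtain ⟨m1, m2, m3⟩ := root_mem_triangle h1 h2
    exact atom_mul_atom_eq (p := ⟨(s, t), hst⟩) (q := ⟨(r, s), hrs⟩) (r := ⟨(r, s), hrs⟩)
      (s := ⟨(r, t), hrt⟩) m1 m3 (swap_triangle h1.ne h2.ne (h1.trans h2).ne).2
  comm_far p q h := by
    obtain ⟨e, h1, h2⟩ := root_mem_comm (Or.inl h)
    exact atom_mul_atom_eq h1 h2 e
  comm_nested p q h h' := by
    obtain ⟨e, h1, h2⟩ := root_mem_comm (Or.inr ⟨h, h'⟩)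
    exact atom_mul_atom_eq h1 h2 e

theorem of_eq_prod_atom (l : List (BandIdx n)) (w : Equiv.Perm (Fin n))
    (hw : (permLen (Fin n)).le w (cyc n)) (hl : Reduced (permLen (Fin n)) bandPerm l w) :
    (noncrossing n).of ⟨w, hw⟩ = (l.map atom).prod := by
  induction l generalizing w with
  | nil =>
    obtain ⟨rfl, -⟩ := hl
    exact of_one _
  | cons p l ih =>
    obtain ⟨h1, h2⟩ := hl.cons (atomSystem bandRel_band)
    rw [List.map_cons, List.prod_cons, ← ih _ (h1.inv_mul_le.trans hw) h2]
    exact (of_mul_inv (I := noncrossing n) (s := ⟨bandPerm p, h1.trans hw⟩) (u := ⟨w, hw⟩) h1).symm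

/-- A word for `δ` whose permutation is the descending cycle. -/
theorem exists_delta_word (m : ℕ) (hm : m + 1 ≤ n) : ∃ l : List (BandIdx n), l.length = m ∧
    (l.map band).prod = descProd n 1 m ∧ ∀ x : Fin n, ((l.map bandPerm).prod x : ℕ) =
      if (x : ℕ) = 0 then m else if (x : ℕ) ≤ m then x - 1 else x := by
  induction m with
  | zero =>
    refine ⟨[], rfl, rfl, fun x => ?_⟩
    simp only [List.map_nil, List.prod_nil, Equiv.Perm.one_apply]
    split_ifs <;> omega
  | succ m ih =>
    obtain ⟨l, h1, h2, h3⟩ := ih (by omega)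
    refine ⟨⟨(m + 1, m + 2), by omega⟩ :: l, by simp [h1], ?_, fun x => ?_⟩
    · rw [List.map_cons, List.prod_cons, h2, band_eq_arc, show m + 2 - (m + 1) - 1 = 0 by omega,
        arc_zero, descProd, add_comm 1 m]
    · have h := h3 x
      have hx := x.isLt
      rw [List.map_cons, List.prod_cons, Equiv.Perm.mul_apply, bandPerm, Equiv.swap_apply_def]
      simp only [BandIdx.lo, BandIdx.hi, Fin.ext_iff]
      split_ifs at h ⊢ <;> (try dsimp only) <;> omega

theorem delta_word (hn : 1 ≤ n) : ∃ l : List (BandIdx n), l.length = n - 1 ∧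
    (l.map band).prod = delta n ∧ Reduced (permLen (Fin n)) bandPerm l (cyc n) := by
  obtain ⟨l, h1, h2, h3⟩ := exists_delta_word (n - 1) (by omega : n - 1 + 1 ≤ n)
  refine ⟨l, h1, h2, ?_, by rw [h1, len_cyc hn]⟩
  rw [← inv_inj, ← mul_left_inj (List.map bandPerm l).prod, inv_mul_cancel]
  refine Equiv.ext fun x => Fin.ext ?_
  have hx := x.isLt
  rw [Equiv.Perm.mul_apply, cyc_inv_val, h3, Equiv.Perm.one_apply]
  split_ifs <;> omega

/-- The strongly quasipositive monoid. -/
def sqp (n : ℕ) : Submonoid (Braid n) := Submonoid.closure (Set.range band)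

/-- The dual braid monoid is the monoid of strongly quasipositive braids. -/
theorem exists_dualMon_hom (hn : 1 ≤ n) : ∃ π : DualMon n →* Braid n, Function.Injective π ∧
    (∀ x, x ∈ sqp n ↔ ∃ y, π y = x) ∧ π (noncrossing n).garside = delta n := by
  have hA := atomSystem (bandRel_band (n := n))
  obtain ⟨f, hf1, hf2⟩ := hA.exists_lift
  let π : DualMon n →* Braid n := PresentedMonoid.lift (fun s => f s.1) (by
    intro x y h
    cases h with
    | one =>
      rw [FreeMonoid.lift_eval_of, map_one]
      exact hf1 [] 1 ((permLen _).one_le _) ⟨rfl, (permLen (Fin n)).len_one.symm⟩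
    | mul s t u h hle =>
      rw [map_mul, FreeMonoid.lift_eval_of, FreeMonoid.lift_eval_of, FreeMonoid.lift_eval_of]
      have := hf2 s.1 t.1 (h ▸ u.2) (h ▸ hle)
      rw [this, h])
  have hπ : ∀ s, π ((noncrossing n).of s) = f s.1 := fun s => rfl
  have hπa : ∀ p, π (atom p) = band p := by
    intro p
    refine (hf1 [p] (bandPerm p) (swap_le_cyc (lo_lt_hi p).ne) ⟨by simp, ?_⟩).trans (by simp)
    rw [bandPerm, len_swap (lo_lt_hi p).ne]; rfl
  refine ⟨π, ?_, fun x => ⟨fun hx => ?_, ?_⟩, ?_⟩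
  -- The atoms satisfy the band relations in `Rˣ`, so the braid group maps there, and the composite
  -- with `π` is the embedding `ι`.
  · obtain ⟨R, _, ι, hι⟩ := exists_embedding (I := noncrossing n) (cyc_pow n) (by omega)
    obtain ⟨φ, hφ⟩ := BandRel.exists_hom (b := fun p => ι (atom p)) (n := n)
      { triangle_left := fun r s t h1 h2 h3 => by
          rw [← map_mul, ← map_mul, bandRel_atom.triangle_left r s t h1 h2 h3]
        triangle_right := fun r s t h1 h2 h3 => by
          rw [← map_mul, ← map_mul, bandRel_atom.triangle_right r s t h1 h2 h3]
        comm_far := fun p q h => by rw [← map_mul, ← map_mul, bandRel_atom.comm_far p q h]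
        comm_nested := fun p q h h' => by
          rw [← map_mul, ← map_mul, bandRel_atom.comm_nested p q h h'] }
    have key : φ.comp π = ι := by
      refine PresentedMonoid.ext _ fun s => ?_
      obtain ⟨l, hl⟩ := hA.exists_reduced _ s.1 s.2 rfl
      have h1 := of_eq_prod_atom l s.1 s.2 hl
      show φ (π ((noncrossing n).of s)) = ι ((noncrossing n).of s)
      rw [h1, map_list_prod, map_list_prod, map_list_prod, List.map_map, List.map_map, List.map_map]
      congr 1
      refine List.map_congr_left fun p _ => ?_
      simp only [Function.comp_apply, hπa, hφ]
    intro x y hxy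
    apply hι
    rw [← key, MonoidHom.comp_apply, MonoidHom.comp_apply, hxy]
  · have : sqp n ≤ MonoidHom.mrange π := by
      rw [sqp, Submonoid.closure_le]
      rintro _ ⟨p, rfl⟩
      exact ⟨atom p, hπa p⟩
    exact this hx
  · rintro ⟨y, rfl⟩
    induction y using Mon.induction with
    | one => rw [map_one]; exact one_mem _
    | mul s x ih =>
      rw [map_mul]
      refine mul_mem ?_ ih
      obtain ⟨l, hl⟩ := hA.exists_reduced _ s.1 s.2 rfl
      rw [hπ, hf1 l s.1 s.2 hl]
      refine list_prod_mem fun z hz => ?_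
      obtain ⟨p, -, rfl⟩ := List.mem_map.1 hz
      exact Submonoid.subset_closure ⟨p, rfl⟩
  · obtain ⟨l, -, h2, h3⟩ := delta_word hn
    rw [← h2]
    exact hf1 l _ ((permLen _).le_refl _) h3

end BraidGrp

/-! ### Divisors of powers of the Garside element. -/

namespace IntervalLattice

variable {W : Type*} [Group W] {I : IntervalLattice W}

theorem exists_mem_bounded (x : I.Mon) : ∃ k, x ∈ I.bounded k := by
  induction x using Mon.induction with
  | one => exact ⟨0, [], le_rfl, rfl⟩
  | mul s x ih =>
    obtain ⟨k, l, hl, rfl⟩ := ih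
    exact ⟨k + 1, s :: l, by simpa using hl, by simp⟩

theorem mul_of_mem_bounded {k : ℕ} {x : I.Mon} (hk : k ≠ 0) (h : x ∈ I.bounded (k - 1))
    (s : I.Simple) : x * I.of s ∈ I.bounded k := by
  obtain ⟨l, hl, rfl⟩ := h
  exact ⟨l ++ [s], by simp; omega, by simp⟩

theorem garside_pow_mem_bounded (k : ℕ) : I.garside ^ k ∈ I.bounded k :=
  ⟨List.replicate k ⟨I.top, I.K.le_refl _⟩, by simp, by simp [garside]⟩

theorem exists_conj_bounded {k : ℕ} {x : I.Mon} (h : x ∈ I.bounded k) (j : ℕ) :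
    ∃ y ∈ I.bounded k, x * I.garside ^ j = I.garside ^ j * y := by
  obtain ⟨l, hl, rfl⟩ := h
  refine ⟨_, ⟨l.map conjTop^[j], by simpa using hl, rfl⟩, ?_⟩
  clear hl
  induction l with
  | nil => simp
  | cons s l ih =>
    rw [List.map_cons, List.prod_cons, mul_assoc, ih, ← mul_assoc, of_mul_garside_pow,
      List.map_cons, List.map_cons, List.prod_cons, mul_assoc]

theorem exists_conj_inv_bounded {N : ℕ} (hN : I.top ^ N = 1) (hN0 : N ≠ 0) {k : ℕ} {x : I.Mon}
    (h : x ∈ I.bounded k) : ∃ y ∈ I.bounded k, y * I.garside = I.garside * x := by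
  -- `Δ^N` is central, so conjugation by `Δ^(N-1)` inverts conjugation by `Δ`.
  obtain ⟨y, hy, he⟩ := exists_conj_bounded h (N - 1)
  refine ⟨y, hy, left_cancel (z := I.garside ^ (N - 1)) ?_⟩
  rw [← mul_assoc, ← he, mul_assoc, ← pow_succ, ← mul_assoc, ← pow_succ,
    Nat.sub_add_cancel (by omega), commute_garside_pow hN]

theorem exists_mul_eq_garside_pow {k : ℕ} {x : I.Mon} (h : x ∈ I.bounded k) :
    ∃ u, x * u = I.garside ^ k := by
  obtain ⟨l, hl, rfl⟩ := h
  induction l generalizing k with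
  | nil => exact ⟨I.garside ^ k, by simp⟩
  | cons s l ih =>
    obtain ⟨k, rfl⟩ : ∃ k', k = k' + 1 := ⟨k - 1, by simp at hl; omega⟩
    obtain ⟨u, hu⟩ := ih (k := k) (by simpa using hl)
    refine ⟨u * I.of (I.compl (conjTop^[k] s)), ?_⟩
    rw [List.map_cons, List.prod_cons, mul_assoc, ← mul_assoc _ u, hu, ← mul_assoc,
      of_mul_garside_pow, mul_assoc, of_mul_compl, pow_succ]

/-- Left divisors of `Δ ^ k` are products of at most `k` generators. -/
theorem mem_bounded_of_mul_eq {N : ℕ} (hN : I.top ^ N = 1) (hN0 : N ≠ 0) {k : ℕ} (hk : k ≠ 0)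
    {x y : I.Mon} (h : x * y = I.garside ^ k) : x ∈ I.bounded k := by
  obtain ⟨j, hj⟩ := exists_mem_bounded x
  -- Conjugation by `Δ^k` turns the left divisor `x` into a right divisor `z`; a further conjugation
  -- by `Δ^(k(N-1))` returns `x`.
  obtain ⟨z, -, hz⟩ := exists_conj_bounded hj k
  have h1 : y * z = I.garside ^ k := left_cancel (z := x) (by rw [← mul_assoc, h, hz])
  have h2 : z ∈ I.bounded k := mem_bounded_of_mul hk (h1 ▸ garside_pow_mem_bounded k)
  obtain ⟨w, hw, he⟩ := exists_conj_bounded h2 (k * (N - 1))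
  have h3 : k + k * (N - 1) = N * k := by
    obtain ⟨M, rfl⟩ : ∃ M, N = M + 1 := ⟨N - 1, by omega⟩
    rw [Nat.add_sub_cancel]; ring
  have h4 : x = w := by
    apply left_cancel (z := I.garside ^ (N * k))
    rw [← commute_garside_pow (by rw [pow_mul, hN, one_pow]), ← h3, pow_add, ← mul_assoc, hz,
      mul_assoc, he, mul_assoc]
  exact h4 ▸ hw

end IntervalLattice

/-! ### Exponent sums and strongly quasipositive braids. -/

namespace BraidGrp

open IntervalLattice

variable {n : ℕ}

theorem exists_expHom (n : ℕ) : ∃ φ : Braid n →* Multiplicative ℤ,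
    ∀ p, φ (band p) = Multiplicative.ofAdd 1 :=
  BandRel.exists_hom (b := fun _ => Multiplicative.ofAdd 1)
    ⟨fun _ _ _ _ _ _ => rfl, fun _ _ _ _ _ _ => rfl, fun _ _ _ => rfl, fun _ _ _ _ => rfl⟩

/-- The exponent sum of a braid. -/
noncomputable def expSum (x : Braid n) : ℤ := Multiplicative.toAdd ((exists_expHom n).choose x)

theorem expSum_mul (x y : Braid n) : expSum (x * y) = expSum x + expSum y := by
  rw [expSum, map_mul]; rfl

theorem expSum_one : expSum (1 : Braid n) = 0 := by
  rw [expSum, map_one]; rfl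

theorem expSum_inv (x : Braid n) : expSum x⁻¹ = -expSum x := by
  rw [expSum, map_inv]; rfl

theorem expSum_zpow (x : Braid n) (k : ℤ) : expSum (x ^ k) = k * expSum x := by
  rw [expSum, map_zpow, toAdd_zpow, smul_eq_mul]; rfl

theorem expSum_band (p : BandIdx n) : expSum (band p) = 1 := by
  rw [expSum, (exists_expHom n).choose_spec]; rfl

theorem expSum_conj {x y : Braid n} (h : IsConj x y) : expSum x = expSum y := by
  obtain ⟨c, rfl⟩ := isConj_iff.1 h
  rw [expSum_mul, expSum_mul, expSum_inv]; ring

theorem expSum_prod (l : List (BandIdx n)) : expSum (l.map band).prod = l.length := by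
  induction l with
  | nil => exact expSum_one
  | cons p l ih =>
    rw [List.map_cons, List.prod_cons, expSum_mul, ih, expSum_band, List.length_cons]
    push_cast; ring

theorem expSum_delta (hn : 1 ≤ n) : expSum (delta n) = n - 1 := by
  obtain ⟨l, h1, h2, -⟩ := delta_word hn
  rw [← h2, expSum_prod, h1]
  push_cast [hn]; ring

theorem exists_list {x : Braid n} (h : x ∈ sqp n) : ∃ l : List (BandIdx n), (l.map band).prod = x := by
  induction h using Submonoid.closure_induction with
  | mem x hx =>
    obtain ⟨p, rfl⟩ := hx
    exact ⟨[p], by simp⟩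
  | one => exact ⟨[], rfl⟩
  | mul x y _ _ hx hy =>
    obtain ⟨l, rfl⟩ := hx
    obtain ⟨m, rfl⟩ := hy
    exact ⟨l ++ m, by simp⟩

theorem band_mem (p : BandIdx n) : band p ∈ sqp n := Submonoid.subset_closure ⟨p, rfl⟩

theorem expSum_nonneg {x : Braid n} (h : x ∈ sqp n) : 0 ≤ expSum x := by
  obtain ⟨l, rfl⟩ := exists_list h
  rw [expSum_prod]; positivity

theorem eq_one_of_expSum {x : Braid n} (h : x ∈ sqp n) (hx : expSum x = 0) : x = 1 := by
  obtain ⟨l, rfl⟩ := exists_list h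
  rw [expSum_prod] at hx
  have : l = [] := List.length_eq_zero_iff.1 (by exact_mod_cast hx)
  simp [this]

theorem eq_band_of_expSum {x : Braid n} (h : x ∈ sqp n) (hx : expSum x = 1) : ∃ p, x = band p := by
  obtain ⟨l, rfl⟩ := exists_list h
  rw [expSum_prod] at hx
  obtain ⟨p, rfl⟩ := List.length_eq_one_iff.1 (by exact_mod_cast hx)
  exact ⟨p, by simp⟩

theorem expSum_wordVal_le (V : BandWord n) : expSum (wordVal V) ≤ V.length := by
  induction V with
  | nil => simp [wordVal, expSum_one]
  | cons x V ih =>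
    rw [wordVal, List.map_cons, List.prod_cons, expSum_mul, List.length_cons]
    have : expSum (letterVal x) ≤ 1 := by
      rw [letterVal]
      split_ifs
      · rw [expSum_band]
      · rw [expSum_inv, expSum_band]; norm_num
    rw [wordVal] at ih
    push_cast
    linarith

/-- The positive word with given bands. -/
theorem wordVal_positive (l : List (BandIdx n)) :
    wordVal (l.map fun p => (p, true)) = (l.map band).prod := by
  rw [wordVal, List.map_map]; rfl

theorem negCount_positive (l : List (BandIdx n)) : negCount (l.map fun p => (p, true)) = 0 := by
  simp [negCount, List.countP_eq_zero]

theorem isSQP_iff {x : Braid n} : IsSQP x ↔ x ∈ sqp n := by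
  constructor
  · intro h
    obtain ⟨V₀, hV₀⟩ := exists_wordVal_eq x
    have hne : {k | ∃ V : BandWord n, wordVal V = x ∧ negCount V = k}.Nonempty := ⟨_, V₀, hV₀, rfl⟩
    obtain ⟨V, hV, hk⟩ := Nat.sInf_mem hne
    have h0 : negCount V = 0 := Nat.le_zero.1 (hk.trans_le h)
    rw [← hV]
    refine list_prod_mem fun z hz => ?_
    obtain ⟨⟨p, b⟩, hp, rfl⟩ := List.mem_map.1 hz
    have := List.countP_eq_zero.1 h0 _ hp
    simp only [Bool.not_eq_true', Bool.not_eq_false] at this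
    rw [letterVal, if_pos this]
    exact band_mem p
  · intro h
    obtain ⟨l, rfl⟩ := exists_list h
    exact Nat.sInf_le ⟨_, wordVal_positive l, negCount_positive l⟩

/-- The exponent sum bounds the length of every band word from below, and a positive word attains
it. -/
theorem bandLength_eq {x : Braid n} (h : x ∈ sqp n) : (bandLength x : ℤ) = expSum x := by
  obtain ⟨l, rfl⟩ := exists_list h
  have hmem : (l.map fun p => (p, true)).length ∈
      {k | ∃ V : BandWord n, wordVal V = (l.map band).prod ∧ V.length = k} :=
    ⟨_, wordVal_positive l, rfl⟩
  apply le_antisymm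
  · rw [expSum_prod]
    have := Nat.sInf_le hmem
    rw [List.length_map] at this
    exact_mod_cast this
  · obtain ⟨V, hV, hk⟩ := Nat.sInf_mem ⟨_, hmem⟩
    have h1 := expSum_wordVal_le V
    rw [hV, hk] at h1
    exact h1

theorem isASQP_of_eq {x y : Braid n} (hx : x ∈ sqp n) (hy : y ∈ sqp n) (p : BandIdx n) :
    IsASQP (x * (band p)⁻¹ * y) := by
  obtain ⟨l, rfl⟩ := exists_list hx
  obtain ⟨m, rfl⟩ := exists_list hy
  have key : ∃ V : BandWord n, wordVal V = (l.map band).prod * (band p)⁻¹ * (m.map band).prod ∧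
      negCount V = 1 := by
    refine ⟨l.map (fun p => (p, true)) ++ [(p, false)] ++ m.map fun p => (p, true), ?_, ?_⟩
    · have h1 := wordVal_positive l
      have h2 := wordVal_positive m
      simp only [wordVal] at h1 h2
      simp only [wordVal, List.map_append, List.prod_append, h1, h2]
      simp [letterVal]
    · have h1 := negCount_positive l
      have h2 := negCount_positive m
      simp only [negCount] at h1 h2
      simp only [negCount, List.countP_append, h1, h2]
      simp
  exact Nat.sInf_le key

/-! ### Infimum, supremum and cycling of braids. -/

section Garside

theorem exists_shift (hn : 1 ≤ n) {x : Braid n} (hx : x ∈ sqp n) :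
    (delta n)⁻¹ * x * delta n ∈ sqp n ∧ delta n * x * (delta n)⁻¹ ∈ sqp n := by
  obtain ⟨π, -, hr, hδ⟩ := exists_dualMon_hom hn
  obtain ⟨y, rfl⟩ := (hr x).1 hx
  obtain ⟨k, hk⟩ := exists_mem_bounded y
  constructor
  · obtain ⟨z, -, hz⟩ := exists_conj_bounded hk 1
    rw [pow_one] at hz
    refine (hr _).2 ⟨z, ?_⟩
    rw [← hδ, mul_assoc, ← map_mul, hz, map_mul, inv_mul_cancel_left]
  · obtain ⟨z, -, hz⟩ := exists_conj_inv_bounded (I := noncrossing n) (PermLen.cyc_pow n)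
      (by omega) hk
    refine (hr _).2 ⟨z, ?_⟩
    rw [← hδ, ← map_mul, ← hz, map_mul, mul_inv_cancel_right]

theorem zpow_conj_mem (hn : 1 ≤ n) {x : Braid n} (hx : x ∈ sqp n) (r : ℤ) :
    delta n ^ r * x * delta n ^ (-r) ∈ sqp n := by
  induction r with
  | zero => simpa using hx
  | succ r ih =>
    have := (exists_shift hn ih).2
    convert this using 1
    rw [add_comm, zpow_add, neg_add, add_comm, zpow_add, zpow_one, zpow_neg_one]
    group
  | pred r ih =>
    have := (exists_shift hn ih).1
    convert this using 1
    rw [show -(r : ℤ) - 1 = -1 + -r by ring, zpow_add, neg_add, add_comm (- -1 : ℤ), zpow_add,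
      neg_neg, neg_neg, zpow_one, zpow_neg_one]
    group

/-- The left factor passes through `δ^r` and stays SQP, so comparison with powers of `δ` is
one-sided divisibility. -/
theorem ble_delta_iff (hn : 1 ≤ n) {r : ℤ} {x : Braid n} :
    BLE (delta n ^ r) x ↔ delta n ^ (-r) * x ∈ sqp n := by
  constructor
  · rintro ⟨P, Q, hP, hQ, rfl⟩
    rw [isSQP_iff] at hP hQ
    have := mul_mem (zpow_conj_mem hn hP (-r)) hQ
    rw [neg_neg] at this
    convert this using 1
    group
  · intro h
    refine ⟨1, _, isSQP_iff.2 (one_mem _), isSQP_iff.2 h, ?_⟩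
    group

theorem le_delta_iff (hn : 1 ≤ n) {s : ℤ} {x : Braid n} :
    BLE x (delta n ^ s) ↔ x⁻¹ * delta n ^ s ∈ sqp n := by
  constructor
  · rintro ⟨P, Q, hP, hQ, h⟩
    rw [isSQP_iff] at hP hQ
    have := mul_mem hQ (zpow_conj_mem hn hP (-s))
    rw [neg_neg] at this
    convert this using 1
    rw [inv_mul_eq_iff_eq_mul]
    calc delta n ^ s = P⁻¹ * (P * x * Q) * delta n ^ (-s) * P * delta n ^ s := by rw [← h]; group
      _ = _ := by group
  · intro h
    refine ⟨1, _, isSQP_iff.2 (one_mem _), isSQP_iff.2 h, ?_⟩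
    group

theorem bddAbove_inf (hn : 2 ≤ n) (x : Braid n) : BddAbove {r : ℤ | BLE (delta n ^ r) x} := by
  refine ⟨|expSum x|, fun r hr => ?_⟩
  have h := expSum_nonneg ((ble_delta_iff (by omega)).1 hr)
  rw [expSum_mul, expSum_zpow, expSum_delta (by omega)] at h
  have h1 : (2 : ℤ) ≤ n := by exact_mod_cast hn
  have h2 := le_abs_self (expSum x)
  by_contra hlt
  push Not at hlt
  have := abs_nonneg (expSum x)
  nlinarith

theorem bddBelow_sup (hn : 2 ≤ n) (x : Braid n) : BddBelow {s : ℤ | BLE x (delta n ^ s)} := by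
  refine ⟨-|expSum x|, fun s hs => ?_⟩
  have h := expSum_nonneg ((le_delta_iff (by omega)).1 hs)
  rw [expSum_mul, expSum_inv, expSum_zpow, expSum_delta (by omega)] at h
  have h1 : (2 : ℤ) ≤ n := by exact_mod_cast hn
  have h2 := neg_abs_le (expSum x)
  by_contra hlt
  push Not at hlt
  have := abs_nonneg (expSum x)
  nlinarith

theorem delta_pow_commute (hn : 1 ≤ n) (x : Braid n) : delta n ^ n * x = x * delta n ^ n := by
  obtain ⟨π, -, hr, hδ⟩ := exists_dualMon_hom hn
  have hb : ∀ p : BandIdx n, band p ∈ Subgroup.centralizer {delta n ^ n} := by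
    intro p
    obtain ⟨y, hy⟩ := (hr _).1 (band_mem p)
    rw [Subgroup.mem_centralizer_iff]
    rintro _ rfl
    rw [← hy, ← hδ, ← map_pow, ← map_mul, ← map_mul,
      commute_garside_pow (I := noncrossing n) (PermLen.cyc_pow n)]
  obtain ⟨V, rfl⟩ := exists_wordVal_eq x
  have : wordVal V ∈ Subgroup.centralizer {delta n ^ n} := by
    refine list_prod_mem fun z hz => ?_
    obtain ⟨⟨p, b⟩, -, rfl⟩ := List.mem_map.1 hz
    rw [letterVal]
    split_ifs
    exacts [hb p, inv_mem (hb p)]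
  exact Subgroup.mem_centralizer_iff.1 this _ rfl

theorem exists_delta_pow_mul_mem (hn : 1 ≤ n) (x : Braid n) : ∃ k : ℕ, delta n ^ k * x ∈ sqp n := by
  obtain ⟨π, -, hr, hδ⟩ := exists_dualMon_hom hn
  have hδm : delta n ∈ sqp n := (hr _).2 ⟨_, hδ⟩
  have hinv : ∀ p : BandIdx n, ∃ k : ℕ, delta n ^ k * (band p)⁻¹ ∈ sqp n := by
    intro p
    obtain ⟨y, hy⟩ := (hr _).1 (band_mem p)
    obtain ⟨k, hk⟩ := exists_mem_bounded y
    obtain ⟨u, hu⟩ := exists_mul_eq_garside_pow hk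
    have h1 : (band p)⁻¹ * delta n ^ k = π u := by
      rw [← hδ, ← map_pow, ← hu, map_mul, hy, inv_mul_cancel_left]
    refine ⟨k, ?_⟩
    have := zpow_conj_mem hn ((hr _).2 ⟨u, rfl⟩) (k : ℤ)
    rw [← h1, zpow_neg, zpow_natCast] at this
    convert this using 1
    group
  obtain ⟨V, rfl⟩ := exists_wordVal_eq x
  induction V with
  | nil => exact ⟨0, by simp [wordVal]⟩
  | cons z V ih =>
    obtain ⟨k, hk⟩ := ih
    have hz : ∃ j : ℕ, delta n ^ j * letterVal z ∈ sqp n := by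
      rw [letterVal]
      split_ifs
      · exact ⟨0, by simpa using band_mem _⟩
      · exact hinv _
    obtain ⟨j, hj⟩ := hz
    refine ⟨k + j, ?_⟩
    have := mul_mem (zpow_conj_mem hn hj (k : ℤ)) hk
    convert this using 1
    rw [wordVal, List.map_cons, List.prod_cons, ← wordVal, zpow_neg, zpow_natCast, pow_add]
    group

theorem exists_central_mul_mem (hn : 1 ≤ n) (x : Braid n) :
    ∃ k : ℕ, delta n ^ (n * k) * x ∈ sqp n := by
  obtain ⟨π, -, hr, hδ⟩ := exists_dualMon_hom hn
  obtain ⟨k, hk⟩ := exists_delta_pow_mul_mem hn x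
  refine ⟨k, ?_⟩
  obtain ⟨m, rfl⟩ : ∃ m, n = m + 1 := ⟨n - 1, by omega⟩
  rw [add_mul, one_mul, pow_add, mul_assoc]
  exact mul_mem (pow_mem ((hr _).2 ⟨_, hδ⟩) _) hk

/-- Repeated cycling: a conjugate of a strongly quasipositive braid can be conjugated into the
strongly quasipositive monoid without using more canonical factors. -/
theorem exists_conj_cycling {π : DualMon n →* Braid n} (hn : 1 ≤ n) (hπ : Function.Injective π)
    (hr : ∀ x, x ∈ sqp n ↔ ∃ y, π y = x) (hδ : π (noncrossing n).garside = delta n)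
    {k : ℕ} (hk : k ≠ 0) (N : ℕ) : ∀ c Y z : DualMon n, expSum (π c) ≤ N →
      Y ∈ (noncrossing n).bounded k → π c * (delta n)⁻¹ * π Y = π z * π c →
      ∃ w, (noncrossing n).garside * w ∈ (noncrossing n).bounded k ∧
        IsConj ((delta n)⁻¹ * π Y) (π w) := by
  induction N with
  | zero =>
    intro c Y z hc hY h
    have h1 := eq_one_of_expSum ((hr _).2 ⟨c, rfl⟩)
      (le_antisymm (by exact_mod_cast hc) (expSum_nonneg ((hr _).2 ⟨c, rfl⟩)))
    rw [h1, one_mul, mul_one] at h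
    refine ⟨z, ?_, h ▸ IsConj.refl _⟩
    have : (noncrossing n).garside * z = Y := hπ (by rw [map_mul, ← h, hδ, mul_inv_cancel_left])
    rwa [this]
  | succ N ih =>
    intro c Y z hc hY h
    obtain ⟨j, hj⟩ := exists_mem_bounded c
    obtain ⟨d, -, hd⟩ := exists_conj_inv_bounded (I := noncrossing n) (PermLen.cyc_pow n)
      (by omega) hj
    have hd' : π d = delta n * π c * (delta n)⁻¹ := by
      rw [eq_mul_inv_iff_mul_eq, ← hδ, ← map_mul, hd, map_mul]
    -- The conjugacy equation reads `(δcδ⁻¹) Y = δ z c`, so `Δ` divides `d * Y`, hence `d * head Y`.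
    have h1 : d * Y = (noncrossing n).garside * (z * c) := by
      apply hπ
      rw [map_mul, map_mul, map_mul, hd', hδ, ← h]
      group
    obtain ⟨c', hc'⟩ := garside_dvd_head h1
    obtain ⟨i, hi⟩ := exists_mem_bounded (tail Y)
    obtain ⟨Y₁, hY₁, hY₁'⟩ := exists_conj_inv_bounded (I := noncrossing n) (PermLen.cyc_pow n)
      (by omega) (tail_mem_bounded hY)
    have e1 : π (of _ (head Y)) * π (tail Y) = π Y := by rw [← map_mul, head_mul_tail]
    have e2 : π Y₁ = delta n * π (tail Y) * (delta n)⁻¹ := by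
      rw [eq_mul_inv_iff_mul_eq, ← hδ, ← map_mul, hY₁', map_mul]
    have e3 : π c' = π c * (delta n)⁻¹ * π (of _ (head Y)) := by
      have := congrArg π hc'
      rw [map_mul, map_mul, hd', hδ, ← inv_mul_eq_iff_eq_mul] at this
      rw [← this]
      group
    by_cases hhead : (head Y).1 = (noncrossing n).top
    · refine ⟨tail Y, ?_, ?_⟩
      · have : (noncrossing n).garside = of _ (head Y) := by
          rw [garside]; congr 1; exact Subtype.ext hhead.symm
        rwa [this, head_mul_tail]
      · have : of _ (head Y) = (noncrossing n).garside := by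
          rw [garside]; congr 1; exact Subtype.ext hhead
        rw [← e1, this, hδ, inv_mul_cancel_left]
    have hlt : expSum (π (of _ (head Y))) < n - 1 := by
      have h2 := congrArg (fun x => expSum (π x)) (of_mul_compl (head Y))
      simp only [map_mul, hδ, expSum_mul, expSum_delta hn] at h2
      have h3 := expSum_nonneg ((hr _).2 ⟨of _ (compl _ (head Y)), rfl⟩)
      refine lt_of_le_of_ne (by linarith) fun h4 => hhead ?_
      have h5 := eq_one_of_expSum ((hr _).2 ⟨of _ (compl _ (head Y)), rfl⟩) (by linarith)
      have h6 : of _ (head Y) = (noncrossing n).garside := by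
        rw [← of_mul_compl (head Y), hπ (h5.trans (map_one π).symm), mul_one]
      have h7 := congrArg head h6
      rw [garside, head_of, head_of] at h7
      rw [h7]
    -- The exponent sum falls by `hlt`. The tail has lost a factor, so restoring the head on the
    -- right keeps the word within `k` factors.
    obtain ⟨w, hw, hconj⟩ := ih c' (Y₁ * of _ (head Y)) z (by
        rw [e3, expSum_mul, expSum_mul, expSum_inv, expSum_delta hn]
        push_cast at hc
        linarith) (mul_of_mem_bounded hk hY₁ _) (by
        rw [map_mul, e2, e3]
        calc _ = (π c * (delta n)⁻¹ * (π (of _ (head Y)) * π (tail Y))) * (delta n)⁻¹ *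
              π (of _ (head Y)) := by group
          _ = _ := by rw [e1, h]; group)
    refine ⟨w, hw, IsConj.trans ?_ hconj⟩
    rw [isConj_iff]
    refine ⟨((delta n)⁻¹ * π (of _ (head Y)))⁻¹, ?_⟩
    rw [map_mul, e2, ← e1]
    group

end Garside

/-! ### The two halves of the proposition. -/

/-- A braid in the super summit set of a strongly quasipositive braid does not have infimum `-1`. -/
theorem not_isConj_sqp (hn : 2 ≤ n) {β β' γ : Braid n} (hβ' : β' ∈ SSS β) (hinf : binf β' = -1)
    (hγ : IsConj β γ) (hγs : IsSQP γ) : False := by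
  have hn1 : 1 ≤ n := by omega
  obtain ⟨π, hπ, hr, hδ⟩ := exists_dualMon_hom hn1
  obtain ⟨hβ, hmin⟩ := hβ'
  -- The supremum of the empty set is `0` by default, so the value `-1` rules it out.
  have hne : {r : ℤ | BLE (delta n ^ r) β'}.Nonempty := by
    by_contra h
    rw [Set.not_nonempty_iff_eq_empty] at h
    rw [binf, h, Int.csSup_empty] at hinf
    omega
  have hmem := Int.csSup_mem hne (bddAbove_inf hn β')
  rw [← binf, hinf, Set.mem_ofPred_eq, ble_delta_iff hn1, neg_neg, zpow_one, hr] at hmem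
  obtain ⟨Y, hY⟩ := hmem
  have hYβ : (delta n)⁻¹ * π Y = β' := by rw [hY, inv_mul_cancel_left]
  have hβγ : IsConj β' γ := hβ.symm.trans hγ
  obtain ⟨g, hg⟩ := isConj_iff.1 hβγ
  obtain ⟨z, hz⟩ := (hr γ).1 (isSQP_iff.1 hγs)
  obtain ⟨j, hj⟩ := exists_central_mul_mem hn1 g
  obtain ⟨c, hc⟩ := (hr _).1 hj
  have hcent : delta n ^ (n * j) * γ = γ * delta n ^ (n * j) := by
    rw [pow_mul]
    exact ((show Commute (delta n ^ n) γ from delta_pow_commute hn1 γ).pow_left j).eq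
  have hcY : π c * (delta n)⁻¹ * π Y = π z * π c := by
    rw [mul_assoc, hYβ, hc, hz, ← mul_assoc, ← hcent, ← hg]
    group
  have hsup : {s : ℤ | BLE β' (delta n ^ s)}.Nonempty := by
    obtain ⟨k, hk⟩ := exists_mem_bounded Y
    obtain ⟨u, hu⟩ := exists_mul_eq_garside_pow hk
    refine ⟨k - 1, (le_delta_iff hn1).2 ((hr _).2 ⟨u, ?_⟩)⟩
    have := congrArg π hu
    rw [map_mul, map_pow, hδ, ← eq_inv_mul_iff_mul_eq] at this
    rw [this, ← hYβ, sub_eq_add_neg, add_comm, zpow_add, zpow_neg_one, zpow_natCast]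
    group
  have htmem := Int.csInf_mem hsup (bddBelow_sup hn β')
  rw [← bsup, Set.mem_ofPred_eq, le_delta_iff hn1, hr] at htmem
  obtain ⟨u, hu⟩ := htmem
  generalize ht : bsup β' = t at hu
  have hYu : π Y * π u = delta n ^ (t + 1) := by
    rw [hu, ← hYβ, add_comm, zpow_add, zpow_one]; group
  have hn' : (2 : ℤ) ≤ n := by exact_mod_cast hn
  -- `Y` has the exponent sum of `γ` plus `n - 1`, which is positive, and it divides `δ^(t+1)`.
  have ht0 : 0 < t + 1 := by
    have h1 := congrArg expSum hYu
    rw [expSum_mul, expSum_zpow, expSum_delta hn1] at h1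
    have h2 := expSum_nonneg ((hr _).2 ⟨u, rfl⟩)
    have h3 : expSum β' = expSum γ := expSum_conj hβγ
    rw [← hYβ, expSum_mul, expSum_inv, expSum_delta hn1] at h3
    have h4 := expSum_nonneg (isSQP_iff.1 hγs)
    by_contra h5
    push Not at h5
    nlinarith
  obtain ⟨k, hk⟩ := Int.eq_ofNat_of_zero_le ht0.le
  have hk0 : k ≠ 0 := by rintro rfl; omega
  have hYb : Y ∈ (noncrossing n).bounded k := by
    refine mem_bounded_of_mul_eq (I := noncrossing n) (PermLen.cyc_pow n) (by omega) hk0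
      (y := u) (hπ ?_)
    rw [map_mul, map_pow, hδ, hYu, hk, zpow_natCast]
  obtain ⟨w, hw, hconj⟩ := exists_conj_cycling hn1 hπ hr hδ hk0 (expSum (π c)).toNat c Y z
    (Int.self_le_toNat _) hYb hcY
  rw [hYβ] at hconj
  -- The canonical length of `π w` is at most `t`, while that of `β'` is `t + 1`.
  have hle := hmin (π w) (hβ.trans hconj)
  have h1 : 0 ≤ binf (π w) := by
    refine le_csSup (bddAbove_inf hn _) ?_
    rw [Set.mem_ofPred_eq, ble_delta_iff hn1, hr]
    exact ⟨w, by simp⟩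
  have h2 : bsup (π w) ≤ t := by
    refine csInf_le (bddBelow_sup hn _) ?_
    obtain ⟨v, hv⟩ := exists_mul_eq_garside_pow hw
    rw [Set.mem_ofPred_eq, le_delta_iff hn1, hr]
    refine ⟨v, ?_⟩
    have := congrArg π hv
    rw [map_mul, map_mul, map_pow, hδ, mul_assoc, ← zpow_natCast, ← hk,
      add_comm, zpow_add, zpow_one, mul_right_inj] at this
    rw [← this, inv_mul_cancel_left]
  rw [canLength, canLength, hinf, ht] at hle
  omega

theorem isCnFct_mem {A : Braid n} (h : IsCnFct A) : A ∈ sqp n := by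
  obtain ⟨⟨P, Q, hP, hQ, rfl⟩, -⟩ := h
  rw [mul_one]
  exact mul_mem (isSQP_iff.1 hP) (isSQP_iff.1 hQ)

/-- A canonical factor of length `n - 2` is `δ` with one band removed. -/
theorem exists_eq_delta_mul_inv (hn : 2 ≤ n) {A : Braid n} (h : IsCnFct A)
    (hA : bandLength A = n - 2) : ∃ p : BandIdx n, A = delta n * (band p)⁻¹ := by
  have hn1 : 1 ≤ n := by omega
  have h1 := bandLength_eq (isCnFct_mem h)
  rw [hA] at h1
  push_cast [hn] at h1
  have h2 := h.2
  rw [← zpow_one (delta n), le_delta_iff hn1, zpow_one] at h2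
  -- The exponent sum of `A⁻¹δ` is `(n - 1) - (n - 2)`.
  obtain ⟨p, hp⟩ := eq_band_of_expSum h2 (by
    rw [expSum_mul, expSum_inv, expSum_delta hn1]; linarith)
  exact ⟨p, by rw [← hp]; group⟩

theorem isASQP_of_isLCF (hn : 2 ≤ n) {β : Braid n} {L : List (Braid n)} (hL : IsLCF β (-1) L)
    {A : Braid n} (hA : A ∈ L) (hlen : bandLength A = n - 2) : IsASQP β := by
  obtain ⟨p, hp⟩ := exists_eq_delta_mul_inv hn (hL.cnFct A hA).1 hlen
  obtain ⟨L₁, L₂, rfl⟩ := List.append_of_mem hA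
  have hmem : ∀ L' : List (Braid n), (∀ B ∈ L', B ∈ L₁ ++ A :: L₂) → L'.prod ∈ sqp n :=
    fun L' h => list_prod_mem fun B hB => isCnFct_mem (hL.cnFct B (h B hB)).1
  have h1 := hmem L₁ fun B hB => by simp [hB]
  have h2 := hmem L₂ fun B hB => by simp [hB]
  have h3 := (exists_shift (by omega) h1).1
  have := isASQP_of_eq h3 h2 p
  convert this using 1
  rw [hL.eq_prod, List.prod_append, List.prod_cons, hp, zpow_neg_one]
  group

end BraidGrp

theorem proposition3p4 (n : ℕ) (hn : 2 ≤ n) (β : BraidGrp.Braid n)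
    (h : ∃ β' ∈ BraidGrp.SSS β, BraidGrp.binf β' = -1 ∧
      ∃ L : List (BraidGrp.Braid n), BraidGrp.IsLCF β' (-1) L ∧
        ∃ A ∈ L, BraidGrp.bandLength A = n - 2) :
    (∃ γ : BraidGrp.Braid n, IsConj β γ ∧ BraidGrp.IsASQP γ) ∧
      ¬ ∃ γ : BraidGrp.Braid n, IsConj β γ ∧ BraidGrp.IsSQP γ := by
  obtain ⟨β', hβ', hinf, L, hL, A, hA, hlen⟩ := h
  exact ⟨⟨β', hβ'.1, BraidGrp.isASQP_of_isLCF hn hL hA hlen⟩,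
    fun ⟨γ, hγ, hγs⟩ => BraidGrp.not_isConj_sqp hn hβ' hinf hγ hγs⟩
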